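/- Let $\Bbbk$ be a field of characteristic $0$ and let $n\ge 3$. Let $\mathcal D_n$ be the type D Coxeter arrangement in $\mathbb C^n$, consisting of the $n(n-1)$ hyperplanes $H_{p,q}^{\pm}=\ker(x_p\pm x_q)$, $1\le p<q\le n$. Let $E$ be the exterior algebra over $\Bbbk$ on generators $e_H$, $H\in\mathcal D_n$, and let $A=E/I$ be the Orlik–Solomon algebra of $\mathcal D_n$ (isomorphic to the cohomology algebra of the complement with coefficients in $\Bbbk$): the ideal $I$ is generated by the elements $\partial(e_{H_1}\cdots e_{H_m})$, where $\{H_1,\dots,H_m\}$ is a minimally dependent set of hyperplanes and $\partial$ is the graded derivation of $E$ of degree $-1$ with $\partial e_H=1$. Identify $A^1$ with $\Bbbk^{n(n-1)}$ by means of the $e_H$. For $a\in A^1$ let $(A,a)$ be the cochain complex $A^0\to A^1\to A^2\to\cdots$ given by right multiplication by $a$, and let $$\mathcal R^1(\mathcal D_n)=\{a\in A^1 \mid H^1(A,a)\ne 0\}$$ be the first resonance variety. For a subarrangement $\mathcal B\subset\mathcal D_n$ and a partition $\Pi$ of $\mathcal B$ into blocks, let $L_{\Pi}$ be the linear space of all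 $u=\sum_H u_He_H\in \Bbbk^{n(n-1)}$ such that $\sum_H u_H=0$, such that $\sum_{H\supseteq X}u_H=0$ for each codimension two intersection $X$ of hyperplanes of $\mathcal B$ for which the hyperplanes of $\mathcal B$ containing $X$ do not all lie in one block of $\Pi$, and such that $u_H=0$ for $H\notin\mathcal B$. Define the following spaces $L_\Pi$. * For $1\le i<j<k\le n$ and $q=1,\dots,4$: $U^q_{i,j,k}=L_\Pi$, where $\mathcal B=\{H_{i,j}^{a},H_{i,k}^{b},H_{j,k}^{c}\}$ with $(a,b,c)=(-,-,-),\ (+,-,+),\ (-,+,+),\ (+,+,-)$ for $q=1,2,3,4$ respectively, and $\Pi$ has three blocks of one element. * For $1\le i<j<k\le n$: $V_{i,j,k}=L_\Pi$, where $\mathcal B=\{H_{i,j}^{\pm},H_{i,k}^{\pm},H_{j,k}^{\pm}\}$ and the blocks of $\Pi$ are $\{H_{i,j}^{\pm}\}$, $\{H_{i,k}^{\pm}\}$, $\{H_{j,k}^{\pm}\}$. * For $1\le i<j<k<l\le n$ and $q=1,\dots,8$: $V^q_{i,j,k,l}=L_\Pi$, where $\mathcal B$ consists of the six hyperplanes $H_{i,j},H_{i,k},H_{i,l},H_{j,k},H_{j,l},H_{k,l}$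 with, in this order, the signs $1\colon(-,-,-,-,-,-)$, $2\colon(+,+,+,-,-,-)$, $3\colon(-,+,+,+,+,-)$, $4\colon(-,-,+,-,+,+)$, $5\colon(+,-,+,+,-,+)$, $6\colon(-,+,-,+,-,+)$, $7\colon(+,+,-,-,+,+)$, $8\colon(+,-,-,+,+,-)$, and $\Pi$ has three blocks of two elements, the hyperplanes of $\mathcal B$ with index pairs $\{i,j\},\{k,l\}$, those with index pairs $\{i,k\},\{j,l\}$, and those with index pairs $\{i,l\},\{j,k\}$. * For $1\le i<j<k<l\le n$: $W_{i,j,k,l}=L_\Pi$, where $\mathcal B$ consists of the twelve hyperplanes $H_{p,q}^{\pm}$ with $p<q$ in $\{i,j,k,l\}$, and $\Pi$ has the three blocks $\{H_{i,j}^{\pm},H_{k,l}^{\pm}\}$, $\{H_{i,k}^{\pm},H_{j,l}^{\pm}\}$, $\{H_{i,l}^{\pm},H_{j,k}^{\pm}\}$. Then $$\mathcal R^1(\mathcal D_n)=\bigcup_{i<j<k}\Bigl(V_{i,j,k}\cup\bigcup_{q=1}^4U^q_{i,j,k}\Bigr)\cup\bigcup_{i<j<k<l}\Bigl(W_{i,j,k,l}\cup\bigcup_{q=1}^8V^q_{i,j,k,l}\Bigr).$$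 All the listed linear spaces have dimension two, they are exactly the irreducible components of $\mathcal R^1(\mathcal D_n)$ (in the Zariski topology), and the number of irreducible components is $5\binom n3+9\binom n4$. -/

import Mathlib

/-! ### Orlik–Solomon algebras -/

section OrlikSolomon

variable {ι V : Type*} [AddCommGroup V] [Module ℂ V]

/-- A finite central arrangement in the complex vector space `V` is given by a family `f` of
defining linear forms, the hyperplanes being `H i = ker (f i)`.  A circuit is a minimally
dependent set of hyperplanes. -/
def IsCircuit (f : ι → Module.Dual ℂ V) (S : Set ι) : Prop :=
  Minimal (fun T : Set ι => ¬ LinearIndepOn ℂ f T) S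

variable (K : Type*) [Field K] [Fintype ι] [DecidableEq ι]

/-- The generator `e i` of the exterior algebra `E` on the hyperplanes. -/
noncomputable def osGen (i : ι) : ExteriorAlgebra K (ι → K) :=
  ExteriorAlgebra.ι K (Pi.single i 1)

/-- The boundary `∂ : E → E`: the linear map with `∂ 1 = 0`, `∂ (e i) = 1` and
`∂ (u v) = (∂ u) v + (-1)^|u| u (∂ v)`, i.e. contraction with the linear form
`∑ u_i e_i ↦ ∑ u_i`. -/
noncomputable def osBoundary : ExteriorAlgebra K (ι → K) →ₗ[K] ExteriorAlgebra K (ι → K) :=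
  CliffordAlgebra.contractLeft (Q := (0 : QuadraticForm K (ι → K)))
    (∑ i : ι, LinearMap.proj i)

/-- The Orlik–Solomon ideal: the two-sided ideal of `E` generated by the boundaries
`∂ (e_{i₁} ⋯ e_{i_k})`, where `i₁, …, i_k` are distinct and form a circuit. -/
noncomputable def osIdeal (f : ι → Module.Dual ℂ V) :
    TwoSidedIdeal (ExteriorAlgebra K (ι → K)) :=
  TwoSidedIdeal.span {g | ∃ l : List ι, l.Nodup ∧ IsCircuit f {i | i ∈ l} ∧
    g = osBoundary K (l.map (osGen K)).prod}

/-- The Orlik–Solomon algebra `A = E / I` with coefficients in `K`, isomorphic to the cohomology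
algebra of the complement of the arrangement. -/
abbrev OSAlgebra (f : ι → Module.Dual ℂ V) : Type _ :=
  ExteriorAlgebra K (ι → K) ⧸ (osIdeal K f).asIdeal

/-- The projection `E → A`. -/
noncomputable def osProj (f : ι → Module.Dual ℂ V) :
    ExteriorAlgebra K (ι → K) →ₐ[K] OSAlgebra K f :=
  Ideal.Quotient.mkₐ K (osIdeal K f).asIdeal

/-- The homogeneous part `A^k`, the image of `⋀^k`. -/
noncomputable def osGraded (f : ι → Module.Dual ℂ V) (k : ℕ) : Submodule K (OSAlgebra K f) :=
  (⋀[K]^k (ι → K)).map (osProj K f).toLinearMap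

/-- The degree one element `∑ u_i e_i` of `A`. -/
noncomputable def osDegOne (f : ι → Module.Dual ℂ V) (u : ι → K) : OSAlgebra K f :=
  osProj K f (ExteriorAlgebra.ι K u)

end OrlikSolomon

/-! ### The first resonance variety -/

section Resonance

variable {K A : Type*} [Field K] [Ring A] [Algebra K A]

/-- For a graded algebra with graded pieces `𝒜 k`: the 1-cocycles of the complex `(A, a)`
whose differential is right multiplication by `a ∈ A¹`. -/
noncomputable def aomotoCocycles (𝒜 : ℕ → Submodule K A) (a : A) : Submodule K A :=
  𝒜 1 ⊓ LinearMap.ker (LinearMap.mulRight K a)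

/-- The 1-coboundaries of `(A, a)`. -/
noncomputable def aomotoCoboundaries (𝒜 : ℕ → Submodule K A) (a : A) : Submodule K A :=
  (𝒜 0).map (LinearMap.mulRight K a)

/-- `H¹(A, a)`. -/
abbrev AomotoH1 (𝒜 : ℕ → Submodule K A) (a : A) : Type _ :=
  aomotoCocycles 𝒜 a ⧸ (aomotoCoboundaries 𝒜 a).submoduleOf (aomotoCocycles 𝒜 a)

end Resonance

/-- The first resonance variety `{a ∈ A¹ | H¹(A, a) ≠ 0}` of an arrangement (with pairwise
distinct hyperplanes), where `A¹ = E¹` is identified with `K^ι` by means of the generators `e i`. -/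
def resonanceVariety (K : Type*) [Field K] {ι V : Type*} [Fintype ι] [DecidableEq ι]
    [AddCommGroup V] [Module ℂ V] (f : ι → Module.Dual ℂ V) : Set (ι → K) :=
  {u | Nontrivial (AomotoH1 (osGraded K f) (osDegOne K f u))}

section Components

variable {ι V κ : Type*} [AddCommGroup V] [Module ℂ V]

/-- `X` is a rank two flat of the subarrangement `B`: the intersection of two different
hyperplanes of `B`. -/
def IsRankTwoFlat (f : ι → Module.Dual ℂ V) (B : Set ι) (X : Submodule ℂ V) : Prop :=
  ∃ g ∈ B, ∃ h ∈ B, LinearMap.ker (f g) ≠ LinearMap.ker (f h) ∧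
    X = LinearMap.ker (f g) ⊓ LinearMap.ker (f h)

/-- A partition `Π` of the subarrangement `B` is given by a colouring `c`; its blocks are the colour
classes in `B`.  The flat `X` is polychrome if the hyperplanes of `B` containing it do
not all lie in one block. -/
def IsPolychrome (f : ι → Module.Dual ℂ V) (B : Set ι) (c : ι → κ) (X : Submodule ℂ V) : Prop :=
  ∃ g ∈ B, ∃ h ∈ B, X ≤ LinearMap.ker (f g) ∧ X ≤ LinearMap.ker (f h) ∧ c g ≠ c h

open Classical in
/-- The linear space `L_Π` of a partition `Π` of the subarrangement `B`: all `u = ∑ u_i e_i` with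
`∑ u_i = 0`, with `∑_{X ⊆ H i} u_i = 0` for each polychrome rank two flat `X` of `B`, and
with `u_i = 0` for each hyperplane `H i` not in `B`. -/
noncomputable def partitionSpace (K : Type*) [Field K] [Fintype ι] (f : ι → Module.Dual ℂ V)
    (B : Set ι) (c : ι → κ) : Submodule K (ι → K) where
  carrier := {u | ∑ i, u i = 0 ∧
    (∀ X : Submodule ℂ V, IsRankTwoFlat f B X → IsPolychrome f B c X →
      ∑ i with X ≤ LinearMap.ker (f i), u i = 0) ∧
    ∀ i, i ∉ B → u i = 0}
  zero_mem' := by simp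
  add_mem' := by
    rintro u v ⟨hu, hu', hu''⟩ ⟨hv, hv', hv''⟩
    refine ⟨?_, fun X hX hX' => ?_, fun i hi => ?_⟩
    · simp [Finset.sum_add_distrib, hu, hv]
    · simp [Finset.sum_add_distrib, hu' X hX hX', hv' X hX hX']
    · simp [hu'' i hi, hv'' i hi]
  smul_mem' := by
    rintro r u ⟨hu, hu', hu''⟩
    refine ⟨?_, fun X hX hX' => ?_, fun i hi => ?_⟩
    · simp [← Finset.mul_sum, hu]
    · simp [← Finset.mul_sum, hu' X hX hX']
    · simp [hu'' i hi]

end Components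

/-! ### Irreducible components in affine space -/

/-- The Zariski topology on the affine space `K^ι`: the sets `{x | p x ≠ 0}` form a basis. -/
abbrev zariskiTopology (K ι : Type*) [Field K] : TopologicalSpace (ι → K) :=
  TopologicalSpace.generateFrom
    {U | ∃ p : MvPolynomial ι K, U = {x | MvPolynomial.eval x p ≠ 0}}

/-- The irreducible components (maximal irreducible subsets, in the Zariski topology) of a subset
of affine space. -/
def zariskiComponents {K ι : Type*} [Field K] (S : Set (ι → K)) : Set (Set (ι → K)) :=
  {Z | Maximal (fun Y => Y ⊆ S ∧ @IsIrreducible (ι → K) (zariskiTopology K ι) Y) Z}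

/-! ### The Coxeter arrangement of type D -/

namespace TypeD

/-- The hyperplanes of `𝒟_n`: the triple `(i, j, s)` with `i < j` and `s = ±1` stands for
`H_{i,j}^s = ker (x_i + s x_j)`. -/
abbrev Hyp (n : ℕ) : Type := {h : Fin n × Fin n × ℤˣ // h.1 < h.2.1}

/-- The linear form `x_i + s x_j` on `ℂ^n`. -/
noncomputable def form {n : ℕ} (h : Hyp n) : Module.Dual ℂ (Fin n → ℂ) :=
  LinearMap.proj h.1.1 + (((h.1.2.2 : ℤˣ) : ℤ) : ℂ) • LinearMap.proj h.1.2.1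

variable {n : ℕ}

/-- The hyperplanes `H_{p,q}^±` with `(p, q)` in a given set of pairs. -/
def pairHyps (P : Set (Fin n × Fin n)) : Set (Hyp n) :=
  {h | (h.1.1, h.1.2.1) ∈ P}

/-- The hyperplanes in a given list. -/
def signedHyps (P : Set (Fin n × Fin n × ℤˣ)) : Set (Hyp n) :=
  {h | h.1 ∈ P}

/-- The partition of a subarrangement according to the pair of indices `{p, q}` of `H_{p,q}^±`. -/
def pairColour (h : Hyp n) : Fin n × Fin n := (h.1.1, h.1.2.1)

/-- The partition of a subarrangement on the indices `i < j < k < l` into three blocks according to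
the partition of the indices into two pairs, one of which is the pair of indices of
the hyperplane: `{i,j},{k,l}` or `{i,k},{j,l}` or `{i,l},{j,k}`. -/
def matchingColour (i j k l : Fin n) (h : Hyp n) : Fin 3 :=
  if pairColour h = (i, j) ∨ pairColour h = (k, l) then 0
  else if pairColour h = (i, k) ∨ pairColour h = (j, l) then 1
  else 2

/-- Signs of the hyperplanes with indices `(i,j), (i,k), (j,k)` in the four subarrangements of
type `𝒜_3` (three hyperplanes through a codimension two subspace). -/
def tripleSigns : Fin 4 → Fin 3 → ℤˣ :=
  ![![-1, -1, -1], ![1, -1, 1], ![-1, 1, 1], ![1, 1, -1]]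

/-- Signs of the hyperplanes with indices `(i,j), (i,k), (i,l), (j,k), (j,l), (k,l)` in the eight
subarrangements of type `𝒜_4` involving all four indices. -/
def quadSigns : Fin 8 → Fin 6 → ℤˣ :=
  ![![-1, -1, -1, -1, -1, -1],
    ![1, 1, 1, -1, -1, -1],
    ![-1, 1, 1, 1, 1, -1],
    ![-1, -1, 1, -1, 1, 1],
    ![1, -1, 1, 1, -1, 1],
    ![-1, 1, -1, 1, -1, 1],
    ![1, 1, -1, -1, 1, 1],
    ![1, -1, -1, 1, 1, -1]]

variable (K : Type*) [Field K]

/-- The component `U_{i,j,k}^q` of the three hyperplanes `H_{i,j}^a, H_{i,k}^b, H_{j,k}^c`, with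
three one-element blocks. -/
noncomputable def U (q : Fin 4) (i j k : Fin n) : Submodule K (Hyp n → K) :=
  partitionSpace K form
    (signedHyps {(i, j, tripleSigns q 0), (i, k, tripleSigns q 1), (j, k, tripleSigns q 2)})
    pairColour

/-- The component `V_{i,j,k}` of the six hyperplanes `H_{i,j}^±, H_{i,k}^±, H_{j,k}^±`, with
blocks `{H_{p,q}^+, H_{p,q}^-}`. -/
noncomputable def V3 (i j k : Fin n) : Submodule K (Hyp n → K) :=
  partitionSpace K form (pairHyps {(i, j), (i, k), (j, k)}) pairColour

/-- The component `V_{i,j,k,l}^q` of six hyperplanes forming an arrangement of type `𝒜_4`, with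
the blocks formed by pairs `H_{p,q}^a, H_{r,s}^b`, `{p,q} ∪ {r,s} = {i,j,k,l}`. -/
noncomputable def V4 (q : Fin 8) (i j k l : Fin n) : Submodule K (Hyp n → K) :=
  partitionSpace K form
    (signedHyps {(i, j, quadSigns q 0), (i, k, quadSigns q 1), (i, l, quadSigns q 2),
      (j, k, quadSigns q 3), (j, l, quadSigns q 4), (k, l, quadSigns q 5)})
    (matchingColour i j k l)

/-- The component `W_{i,j,k,l}` of the twelve hyperplanes `H_{p,q}^±` with `p, q ∈ {i,j,k,l}`, with
the blocks `{H_{p,q}^±, H_{r,s}^±}`, `{p,q} ∪ {r,s} = {i,j,k,l}`. -/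
noncomputable def W (i j k l : Fin n) : Submodule K (Hyp n → K) :=
  partitionSpace K form
    (pairHyps {(i, j), (i, k), (i, l), (j, k), (j, l), (k, l)}) (matchingColour i j k l)

/-- The family of all the linear subspaces listed above. -/
def componentList (n : ℕ) : Set (Submodule K (Hyp n → K)) :=
  {L | (∃ i j k : Fin n, i < j ∧ j < k ∧ (L = V3 K i j k ∨ ∃ q, L = U K q i j k)) ∨
    (∃ i j k l : Fin n, i < j ∧ j < k ∧ k < l ∧ (L = W K i j k l ∨ ∃ q, L = V4 K q i j k l))}

end TypeD

/-!
An element `u` of `A¹` is resonant if and only if some `w` not proportional to `u` satisfies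
`w u = 0` in `A²`. Such a product vanishes if and only if it vanishes locally: for every rank two flat
`X`, the restrictions of `u` and `w` to the hyperplanes through `X` are proportional, or both have
coordinate sum zero (`osDegOne_mul_eq_zero_iff`). Necessity is seen by mapping `A` to the exterior
algebra of a plane, using one coordinate and one coordinate sum; sufficiency by grouping the terms
of the product according to flats and expanding in the products `(e_i - e_g)(e_j - e_g)`, which
are boundaries of circuits of size three.

In the arrangement of type D write a hyperplane as `x_p = τ x_q`, an edge with sign `τ` of a
complete graph. Two distinct hyperplanes on equal or disjoint pairs of indices (orthogonal ones)
have no third hyperplane through their intersection, while two hyperplanes on pairs `{p, q}`,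
`{p, r}` lie on a triangle of three hyperplanes. Hence a resonant `u` with its partner `w` is a
labelling of the signed edges by vectors `(u, w)` in the plane, where labels on orthogonal edges
are proportional and labels on a triangle are proportional or have sum zero. Two adjacent edges
with independent labels span a triangle with three different directions. An edge orthogonal to all
edges of this triangle has label zero; every other edge is orthogonal to exactly one of them,
which fixes the direction of its label if that is nonzero. Following triangles, the support has to
be either a complete graph on three or four vertices with the signs `ε_p ε_q` given by a switching
function `ε`, or the complete graph with all signs on such a vertex set
(`IsResonantLabelling.exists_support`). These are the supports `B` of the listed spaces.

Conversely, for such a `B` with its colouring (`TypeD.IsNet`) the space `L_Π` consists of the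
vectors supported on `B` with sum zero on the triangles in `B`. When `2` is invertible these
equations force equal coordinates on each colour class, so that `L_Π` is two-dimensional and any
two of its elements satisfy the local conditions.

Linear subspaces are closed and, over an infinite field, irreducible in the Zariski topology.
Since the listed spaces have equal dimension, they are the irreducible components once they are
distinct, and they are distinct because `B` can be read off from `L_Π` as its support.
-/

/-! ### Rank two flats and circuits of size three -/

section Circuits

variable {ι V : Type*} [AddCommGroup V] [Module ℂ V] {f : ι → Module.Dual ℂ V}

theorem apply_mem_span_pair_iff {i j k : ι} :
    f k ∈ Submodule.span ℂ {f i, f j} ↔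
      LinearMap.ker (f i) ⊓ LinearMap.ker (f j) ≤ LinearMap.ker (f k) := by
  constructor
  · intro h x hx
    obtain ⟨a, b, h⟩ := Submodule.mem_span_pair.1 h
    rw [Submodule.mem_inf, LinearMap.mem_ker, LinearMap.mem_ker] at hx
    rw [LinearMap.mem_ker, ← h]
    simp [hx.1, hx.2]
  · intro h
    have := mem_span_of_iInf_ker_le_ker (L := ![f i, f j]) (K := f k) (by
      refine le_trans ?_ h
      refine le_inf (iInf_le_of_le 0 le_rfl) (iInf_le_of_le 1 le_rfl))
    simpa [Set.pair_comm] using this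

theorem inf_ker_le_of_not_linearIndepOn (hf : ∀ i j, LinearIndepOn ℂ f {i, j}) {i j k : ι}
    (hki : k ≠ i) (hkj : k ≠ j) (h : ¬ LinearIndepOn ℂ f {k, i, j}) :
    LinearMap.ker (f i) ⊓ LinearMap.ker (f j) ≤ LinearMap.ker (f k) := by
  rw [← apply_mem_span_pair_iff]
  rw [linearIndepOn_insert (by simp [hki, hkj])] at h
  have := not_and.1 h (hf i j)
  simpa [Set.image_pair] using this

theorem isCircuit_triple (hf : ∀ i j, LinearIndepOn ℂ f {i, j}) {i j k : ι}
    (hki : k ≠ i) (hkj : k ≠ j)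
    (h : LinearMap.ker (f i) ⊓ LinearMap.ker (f j) ≤ LinearMap.ker (f k)) :
    IsCircuit f {k, i, j} := by
  rw [← apply_mem_span_pair_iff] at h
  constructor
  · show ¬ LinearIndepOn ℂ f {k, i, j}
    rw [linearIndepOn_insert (by simp [hki, hkj])]
    intro h'
    exact h'.2 (by simpa [Set.image_pair] using h)
  · intro T hT hTS
    by_contra hST
    obtain ⟨x, hx, hxT⟩ := Set.not_subset.1 hST
    apply hT
    have key : ∃ a b, T ⊆ {a, b} := by
      rcases hx with rfl | rfl | rfl
      · exact ⟨i, j, fun y hy => by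
          rcases hTS hy with rfl | h | h
          · exact absurd hy hxT
          · exact .inl h
          · exact .inr h⟩
      · exact ⟨k, j, fun y hy => by
          rcases hTS hy with h | rfl | h
          · exact .inl h
          · exact absurd hy hxT
          · exact .inr h⟩
      · exact ⟨k, i, fun y hy => by
          rcases hTS hy with h | h | rfl
          · exact .inl h
          · exact .inr h
          · exact absurd hy hxT⟩
    obtain ⟨a, b, hab⟩ := key
    exact (hf a b).mono hab

/-- Any two hyperplanes through a rank two flat intersect in that flat. -/
theorem inf_ker_eq_of_le (hf : ∀ i j, LinearIndepOn ℂ f {i, j}) {i j k l : ι} (hkl : k ≠ l)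
    (hk : LinearMap.ker (f i) ⊓ LinearMap.ker (f j) ≤ LinearMap.ker (f k))
    (hl : LinearMap.ker (f i) ⊓ LinearMap.ker (f j) ≤ LinearMap.ker (f l)) :
    LinearMap.ker (f k) ⊓ LinearMap.ker (f l) = LinearMap.ker (f i) ⊓ LinearMap.ker (f j) := by
  refine le_antisymm ?_ (le_inf hk hl)
  rw [← apply_mem_span_pair_iff] at hk hl
  have hle : Submodule.span ℂ {f k, f l} ≤ Submodule.span ℂ {f i, f j} :=
    Submodule.span_le.2 (by rintro _ (rfl | rfl) <;> assumption)
  have hfin : FiniteDimensional ℂ (Submodule.span ℂ {f i, f j}) :=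
    FiniteDimensional.span_of_finite ℂ (Set.toFinite _)
  have h2 : Module.finrank ℂ (Submodule.span ℂ {f k, f l}) = 2 := by
    have h1 : LinearIndependent ℂ ![f k, f l] := by
      have := (hf k l).comp ![⟨k, by simp⟩, ⟨l, by simp⟩] (by
        intro a b hab
        fin_cases a <;> fin_cases b <;> simp_all)
      convert this using 1
      ext a
      fin_cases a <;> rfl
    have hr : Set.range ![f k, f l] = {f k, f l} := by
      simp [Set.pair_comm]
    rw [← hr, finrank_span_eq_card h1, Fintype.card_fin]
  have h2' : Module.finrank ℂ (Submodule.span ℂ {f i, f j}) ≤ 2 := by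
    classical
    refine (finrank_span_le_card (R := ℂ) ({f i, f j} : Set (Module.Dual ℂ V))).trans ?_
    simpa using Finset.card_le_two (a := f i) (b := f j)
  have heq := Submodule.eq_of_le_of_finrank_le hle (by omega)
  refine le_inf (apply_mem_span_pair_iff.1 ?_) (apply_mem_span_pair_iff.1 ?_)
  · rw [heq]; exact Submodule.subset_span (by simp)
  · rw [heq]; exact Submodule.subset_span (by simp)

theorem three_le_length_of_isCircuit (hf : ∀ i j, LinearIndepOn ℂ f {i, j}) {l : List ι}
    (hl : IsCircuit f {i | i ∈ l}) : 3 ≤ l.length := by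
  by_contra h
  apply hl.prop
  match l, h with
  | [], _ => simp
  | [a], _ => exact (hf a a).mono (by simp)
  | [a, b], _ => exact (hf a b).mono (by intro x; simp)
  | _ :: _ :: _ :: _, h => simp at h

end Circuits

/-! ### Products and boundaries in the exterior algebra -/

section Exterior

open ExteriorAlgebra

/-- If `x ∧ y = 0`, contraction with a linear form shows that `x` and `y` are proportional. -/
theorem ExteriorAlgebra.smul_eq_smul_of_ι_mul_ι_eq_zero {K M : Type*} [Field K] [AddCommGroup M]
    [Module K M] {x y : M} (h : ι K x * ι K y = 0) (φ : Module.Dual K M) :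
    φ x • y = φ y • x := by
  have h1 := congrArg (CliffordAlgebra.contractLeft (Q := (0 : QuadraticForm K M)) φ) h
  have h2 := CliffordAlgebra.contractLeft_ι_mul (Q := (0 : QuadraticForm K M)) φ x (ι K y)
  have h3 := CliffordAlgebra.contractLeft_ι (Q := (0 : QuadraticForm K M)) φ y
  change _ = _ - _ * (CliffordAlgebra.contractLeft φ) (CliffordAlgebra.ι 0 y) at h2
  rw [h3, ← Algebra.commutes, ← Algebra.smul_def] at h2
  have h4 : φ x • ι K y - φ y • ι K x = 0 := by
    rw [map_zero] at h1
    exact h2.symm.trans h1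
  rw [← map_smul, ← map_smul, sub_eq_zero, ι_inj] at h4
  exact h4

theorem ExteriorAlgebra.range_ι_pow_eq_bot {K : Type*} [Field K] {m : ℕ} (hm : 3 ≤ m) :
    LinearMap.range (ι K (M := K × K)) ^ m = ⊥ := by
  have h3 : LinearMap.range (ι K (M := K × K)) ^ 3 = ⊥ := by
    have : Module.finrank K (⋀[K]^3 (K × K)) = 0 := by
      rw [exteriorPower.finrank_eq]
      simp
    exact Submodule.finrank_eq_zero.1 this
  obtain ⟨k, rfl⟩ := Nat.exists_eq_add_of_le hm
  rw [pow_add, h3, Submodule.bot_mul]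

variable {K : Type*} [Field K] {ι : Type*}

theorem osBoundary_ι_mul [Fintype ι] (u : ι → K) (w : ExteriorAlgebra K (ι → K)) :
    osBoundary K (ExteriorAlgebra.ι K u * w) =
      (∑ i, u i) • w - ExteriorAlgebra.ι K u * osBoundary K w := by
  have := CliffordAlgebra.contractLeft_ι_mul (Q := (0 : QuadraticForm K (ι → K)))
    (∑ i : ι, LinearMap.proj i) u w
  simpa [osBoundary] using this

theorem osBoundary_one [Fintype ι] : osBoundary K (1 : ExteriorAlgebra K (ι → K)) = 0 :=
  CliffordAlgebra.contractLeft_one (Q := (0 : QuadraticForm K (ι → K))) _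

theorem osBoundary_osGen_mul [Fintype ι] [DecidableEq ι] (i : ι) (w : ExteriorAlgebra K (ι → K)) :
    osBoundary K (osGen K i * w) = w - osGen K i * osBoundary K w := by
  rw [osGen, osBoundary_ι_mul]
  simp

theorem osGen_mul_self [DecidableEq ι] (i : ι) : osGen K i * osGen K i = 0 := ι_sq_zero _

theorem osGen_mul_comm [DecidableEq ι] (i j : ι) :
    osGen K i * osGen K j = -(osGen K j * osGen K i) :=
  eq_neg_of_add_eq_zero_left (ι_add_mul_swap _ _)

/-- The boundary of a product of three generators is itself a product. -/
theorem osBoundary_triple [Fintype ι] [DecidableEq ι] (i j k : ι) :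
    osBoundary K ([i, j, k].map (osGen K)).prod =
      (osGen K j - osGen K i) * (osGen K k - osGen K i) := by
  have h1 : osBoundary K (osGen K k) = 1 := by
    simpa [osBoundary_one] using osBoundary_osGen_mul (K := K) k 1
  simp only [List.map_cons, List.map_nil, List.prod_cons, List.prod_nil, mul_one,
    osBoundary_osGen_mul, h1, mul_sub, sub_mul, osGen_mul_self]
  rw [osGen_mul_comm i j]
  abel

variable {M : Type*} [AddCommGroup M] [Module K M]

theorem map_prod_osGen_mem_pow [DecidableEq ι] (φ : (ι → K) →ₗ[K] M) (l : List ι) :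
    ExteriorAlgebra.map φ (l.map (osGen K)).prod ∈
      LinearMap.range (ExteriorAlgebra.ι K (M := M)) ^ l.length := by
  induction l with
  | nil => simp
  | cons i l ih =>
    rw [List.map_cons, List.prod_cons, map_mul, List.length_cons, pow_succ']
    refine Submodule.mul_mem_mul ?_ ih
    rw [osGen, ExteriorAlgebra.map_apply_ι]
    exact ⟨_, rfl⟩

theorem map_osBoundary_prod_mem_pow [Fintype ι] [DecidableEq ι] (φ : (ι → K) →ₗ[K] M) (l : List ι) :
    ExteriorAlgebra.map φ (osBoundary K (l.map (osGen K)).prod) ∈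
      LinearMap.range (ExteriorAlgebra.ι K (M := M)) ^ (l.length - 1) := by
  induction l with
  | nil => simp [osBoundary_one]
  | cons i l ih =>
    rw [List.map_cons, List.prod_cons, osBoundary_osGen_mul, map_sub, map_mul]
    refine Submodule.sub_mem _ (map_prod_osGen_mem_pow φ l) ?_
    cases l with
    | nil => simp [osBoundary_one]
    | cons j l =>
      rw [List.length_cons, Nat.add_sub_cancel, List.length_cons, pow_succ']
      refine Submodule.mul_mem_mul ?_ ih
      rw [osGen, ExteriorAlgebra.map_apply_ι]
      exact ⟨_, rfl⟩

end Exterior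

/-! ### Degree two relations in an Orlik–Solomon algebra -/

section Resonance

open Classical in
/-- The sum of the coordinates of `u` over the hyperplanes containing the subspace `X`, as a linear
form in `u`. -/
noncomputable def flatSum (K : Type*) [Field K] {ι V : Type*} [Fintype ι] [AddCommGroup V]
    [Module ℂ V] (f : ι → Module.Dual ℂ V) (X : Submodule ℂ V) : (ι → K) →ₗ[K] K :=
  ∑ i with X ≤ LinearMap.ker (f i), LinearMap.proj i

variable {K : Type*} [Field K] {ι V : Type*} [Fintype ι] [DecidableEq ι] [AddCommGroup V]
  [Module ℂ V] {f : ι → Module.Dual ℂ V}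

open Classical in
theorem flatSum_apply {K : Type*} [Field K] {ι V : Type*} [Fintype ι] [AddCommGroup V]
    [Module ℂ V] (f : ι → Module.Dual ℂ V) (X : Submodule ℂ V) (u : ι → K) :
    flatSum K f X u = ∑ i with X ≤ LinearMap.ker (f i), u i := by
  simp [flatSum]

open Classical in
theorem flatSum_single (X : Submodule ℂ V) (i : ι) :
    flatSum K f X (Pi.single i 1) = if X ≤ LinearMap.ker (f i) then 1 else 0 := by
  rw [flatSum_apply, Finset.sum_filter, Finset.sum_eq_single i]
  · simp
  · intro j _ hj
    simp [hj]
  · simp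

open ExteriorAlgebra in
/-- The algebra map to the exterior algebra of the plane which is induced by the coordinate of a
hyperplane `H k ⊇ X` and by the coordinate sum over all hyperplanes containing `X` kills the
Orlik–Solomon ideal. -/
theorem map_eq_zero_of_mem_osIdeal (hf : ∀ i j, LinearIndepOn ℂ f {i, j}) {X : Submodule ℂ V}
    {k : ι} (hk : X ≤ LinearMap.ker (f k)) {x : ExteriorAlgebra K (ι → K)}
    (hx : x ∈ osIdeal K f) :
    ExteriorAlgebra.map ((LinearMap.proj k).prod (flatSum K f X)) x = 0 := by
  set φ : (ι → K) →ₗ[K] K × K := (LinearMap.proj k).prod (flatSum K f X) with hφ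
  have hle : osIdeal K f ≤ TwoSidedIdeal.ker (ExteriorAlgebra.map φ) := by
    refine TwoSidedIdeal.span_le.2 ?_
    rintro _ ⟨l, hnd, hl, rfl⟩
    show _ ∈ TwoSidedIdeal.ker _
    rw [TwoSidedIdeal.mem_ker]
    have h3 := three_le_length_of_isCircuit hf hl
    -- boundaries of longer circuits go to products of three vectors of the plane
    by_cases h4 : 4 ≤ l.length
    · have := map_osBoundary_prod_mem_pow φ l
      rwa [ExteriorAlgebra.range_ι_pow_eq_bot (by omega), Submodule.mem_bot] at this
    obtain ⟨a, b, c, rfl⟩ := List.length_eq_three.1 (show l.length = 3 by omega)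
    simp only [List.nodup_cons, List.mem_cons, List.not_mem_nil, or_false, not_or] at hnd
    obtain ⟨⟨hab, hac⟩, hbc, -⟩ := hnd
    have hset : {i | i ∈ [a, b, c]} = ({a, b, c} : Set ι) := by ext; simp
    rw [hset] at hl
    have hdep : ¬ LinearIndepOn ℂ f {a, b, c} := hl.prop
    have hin : ∀ d, X ≤ LinearMap.ker (f d) →
        φ (Pi.single d 1) = ((Pi.single d 1 : ι → K) k, 1) := by
      intro d hd
      simp [hφ, flatSum_single, hd]
    have hout : ∀ d, ¬ X ≤ LinearMap.ker (f d) → φ (Pi.single d 1) = 0 := by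
      intro d hd
      have : d ≠ k := by rintro rfl; exact hd hk
      simp [hφ, flatSum_single, hd, this.symm]
    have hA : X ≤ LinearMap.ker (f b) → X ≤ LinearMap.ker (f c) → X ≤ LinearMap.ker (f a) :=
      fun hb hc => (le_inf hb hc).trans (inf_ker_le_of_not_linearIndepOn hf hab hac hdep)
    have hB : X ≤ LinearMap.ker (f a) → X ≤ LinearMap.ker (f c) → X ≤ LinearMap.ker (f b) :=
      fun ha hc => (le_inf ha hc).trans (inf_ker_le_of_not_linearIndepOn hf (Ne.symm hab) hbc (by
        rwa [Set.insert_comm]))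
    have hC : X ≤ LinearMap.ker (f a) → X ≤ LinearMap.ker (f b) → X ≤ LinearMap.ker (f c) :=
      fun ha hb => (le_inf ha hb).trans
        (inf_ker_le_of_not_linearIndepOn hf (Ne.symm hac) (Ne.symm hbc) (by
          rwa [Set.insert_comm, Set.pair_comm c b, ← Set.insert_comm, Set.insert_comm]))
    have hz : ∀ (x : K × K) (s t : K),
        ExteriorAlgebra.ι K (s • x) * ExteriorAlgebra.ι K (t • x) = 0 := by
      intro x s t
      rw [map_smul, map_smul, smul_mul_smul_comm, ι_sq_zero, smul_zero]
    rw [osBoundary_triple]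
    simp only [osGen, map_mul, map_sub, ExteriorAlgebra.map_apply_ι]
    rw [← map_sub (ExteriorAlgebra.ι K), ← map_sub (ExteriorAlgebra.ι K)]
    by_cases ha : X ≤ LinearMap.ker (f a) <;> by_cases hb : X ≤ LinearMap.ker (f b) <;>
      by_cases hc : X ≤ LinearMap.ker (f c)
    -- all three hyperplanes contain `X`: both differences are multiples of `(1, 0)`
    · rw [hin a ha, hin b hb, hin c hc]
      convert hz (1, 0) ((Pi.single b 1 : ι → K) k - (Pi.single a 1 : ι → K) k)
        ((Pi.single c 1 : ι → K) k - (Pi.single a 1 : ι → K) k) using 3 <;> simp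
    · exact absurd (hC ha hb) hc
    · exact absurd (hB ha hc) hb
    · rw [hout b hb, hout c hc]
      exact ι_sq_zero _
    · exact absurd (hA hb hc) ha
    · rw [hout a ha, hout c hc]
      simp
    · rw [hout a ha, hout b hb]
      simp
    · rw [hout a ha, hout b hb]
      simp
  have := hle hx
  rwa [TwoSidedIdeal.mem_ker] at this

/-- The Orlik–Solomon ideal contains no nonzero elements of degree one. -/
theorem osDegOne_eq_zero_iff (hf : ∀ i j, LinearIndepOn ℂ f {i, j}) (u : ι → K) :
    osDegOne K f u = 0 ↔ u = 0 := by
  refine ⟨fun h => ?_, fun h => by simp [osDegOne, h]⟩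
  have hu : ExteriorAlgebra.ι K u ∈ osIdeal K f := by
    rw [← TwoSidedIdeal.mem_asIdeal]
    exact Ideal.Quotient.eq_zero_iff_mem.1 h
  funext k
  have h1 := map_eq_zero_of_mem_osIdeal hf (le_refl (LinearMap.ker (f k))) hu
  rw [ExteriorAlgebra.map_apply_ι, ExteriorAlgebra.ι_eq_zero_iff] at h1
  exact congrArg Prod.fst h1

theorem osDegOne_mul_eq_zero_iff_mem (u w : ι → K) :
    osDegOne K f w * osDegOne K f u = 0 ↔
      ExteriorAlgebra.ι K w * ExteriorAlgebra.ι K u ∈ osIdeal K f := by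
  rw [← TwoSidedIdeal.mem_asIdeal, ← Ideal.Quotient.eq_zero_iff_mem, osDegOne, osDegOne, ← map_mul]
  rfl

/-- The part of a degree one element supported on the hyperplanes containing `X`. -/
noncomputable def flatPart (f : ι → Module.Dual ℂ V) (X : Submodule ℂ V) (u : ι → K) :
    ExteriorAlgebra K (ι → K) := by
  classical
  exact ∑ i with X ≤ LinearMap.ker (f i), u i • osGen K i

open Classical in
/-- The local factors of a product lie in the Orlik–Solomon ideal if they are proportional or both
have coordinate sum zero. -/
theorem flatPart_mul_flatPart_mem (hf : ∀ i j, LinearIndepOn ℂ f {i, j}) {g h : ι}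
    {X : Submodule ℂ V} (hX : X = LinearMap.ker (f g) ⊓ LinearMap.ker (f h)) {w u : ι → K}
    (hwu : ∀ k, X ≤ LinearMap.ker (f k) → w k * flatSum K f X u = u k * flatSum K f X w) :
    flatPart f X w * flatPart f X u ∈ osIdeal K f := by
  have hsq : ∀ v : ι → K, flatPart f X v * flatPart f X v = 0 := by
    intro v
    have : flatPart f X v =
        ExteriorAlgebra.ι K (∑ i with X ≤ LinearMap.ker (f i), v i • Pi.single i (1 : K)) := by
      simp [flatPart, osGen]
    rw [this, ExteriorAlgebra.ι_sq_zero]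
  have hsmul : ∀ (v v' : ι → K) (c : K), (∀ k, X ≤ LinearMap.ker (f k) → v k = c * v' k) →
      flatPart f X v = c • flatPart f X v' := by
    intro v v' c hv
    rw [flatPart, flatPart, Finset.smul_sum]
    refine Finset.sum_congr rfl fun i hi => ?_
    rw [hv i (Finset.mem_filter.1 hi).2, mul_smul]
  by_cases hu : flatSum K f X u = 0
  swap
  · rw [hsmul w u (flatSum K f X w / flatSum K f X u) (fun k hk => by
      have := hwu k hk
      field_simp
      linear_combination this), smul_mul_assoc, hsq, smul_zero]
    exact zero_mem _
  by_cases hw : flatSum K f X w = 0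
  swap
  · rw [hsmul u w (flatSum K f X u / flatSum K f X w) (fun k hk => by
      have := hwu k hk
      field_simp
      linear_combination -this), mul_smul_comm, hsq, smul_zero]
    exact zero_mem _
  -- both coordinate sums vanish: expand in the differences `e i - e g`
  have hdiff : ∀ v : ι → K, flatSum K f X v = 0 →
      flatPart f X v = ∑ i with X ≤ LinearMap.ker (f i), v i • (osGen K i - osGen K g) := by
    intro v hv
    rw [flatSum_apply] at hv
    simp only [smul_sub, Finset.sum_sub_distrib, ← Finset.sum_smul, hv, zero_smul, sub_zero]
    rfl
  rw [hdiff u hu, hdiff w hw, Finset.sum_mul_sum]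
  refine sum_mem fun i hi => sum_mem fun j hj => ?_
  rw [smul_mul_smul_comm, Algebra.smul_def]
  refine TwoSidedIdeal.mul_mem_left _ _ _ ?_
  by_cases hig : i = g
  · rw [hig, sub_self, zero_mul]
    exact zero_mem _
  by_cases hjg : j = g
  · rw [hjg, sub_self, mul_zero]
    exact zero_mem _
  by_cases hij : i = j
  · have : (osGen K j - osGen K g) * (osGen K j - osGen K g) = 0 := by
      rw [osGen, osGen, ← map_sub, ExteriorAlgebra.ι_sq_zero]
    rw [hij, this]
    exact zero_mem _
  rw [← osBoundary_triple]
  refine TwoSidedIdeal.subset_span ⟨[g, i, j], by simp [Ne.symm hig, Ne.symm hjg, hij], ?_, rfl⟩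
  have hset : {x | x ∈ [g, i, j]} = ({g, i, j} : Set ι) := by ext; simp
  rw [hset]
  refine isCircuit_triple hf (Ne.symm hig) (Ne.symm hjg) ?_
  have hi' := (Finset.mem_filter.1 hi).2
  have hj' := (Finset.mem_filter.1 hj).2
  rw [hX] at hi' hj'
  rw [inf_ker_eq_of_le hf hij hi' hj']
  exact inf_le_left

/-- The product of two degree one elements vanishes in the Orlik–Solomon algebra if and only if, on
the hyperplanes through each rank two flat, the two elements are proportional or both have
coordinate sum zero. -/
theorem osDegOne_mul_eq_zero_iff (hf : ∀ i j, LinearIndepOn ℂ f {i, j}) (w u : ι → K) :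
    osDegOne K f w * osDegOne K f u = 0 ↔
      ∀ g h, g ≠ h → ∀ k, LinearMap.ker (f g) ⊓ LinearMap.ker (f h) ≤ LinearMap.ker (f k) →
        w k * flatSum K f (LinearMap.ker (f g) ⊓ LinearMap.ker (f h)) u =
          u k * flatSum K f (LinearMap.ker (f g) ⊓ LinearMap.ker (f h)) w := by
  classical
  rw [osDegOne_mul_eq_zero_iff_mem]
  constructor
  · intro hmem g h _ k hk
    have h1 := map_eq_zero_of_mem_osIdeal hf hk hmem
    rw [map_mul, ExteriorAlgebra.map_apply_ι, ExteriorAlgebra.map_apply_ι] at h1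
    have h2 := ExteriorAlgebra.smul_eq_smul_of_ι_mul_ι_eq_zero h1 (LinearMap.fst K K K)
    exact congrArg Prod.snd h2
  · intro hall
    have hexp : ∀ v : ι → K, ExteriorAlgebra.ι K v = ∑ i, v i • osGen K i := by
      intro v
      rw [LinearMap.pi_apply_eq_sum_univ]
      refine Finset.sum_congr rfl fun i _ => ?_
      rw [osGen]
      congr 2
      ext j
      simp [Pi.single_apply, eq_comm]
    rw [hexp, hexp, Finset.sum_mul_sum, ← Finset.sum_product']
    have hdiag : ∑ x : ι × ι, w x.1 • osGen K x.1 * u x.2 • osGen K x.2 =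
        ∑ x : ι × ι with x.1 ≠ x.2, w x.1 • osGen K x.1 * u x.2 • osGen K x.2 := by
      rw [Finset.sum_filter]
      refine Finset.sum_congr rfl fun x _ => ?_
      split_ifs with h
      · rfl
      · rw [not_not.1 h, smul_mul_smul_comm, osGen_mul_self, smul_zero]
    rw [Finset.univ_product_univ, hdiag]
    -- group the ordered pairs of distinct hyperplanes according to their intersection
    set F : ι × ι → Submodule ℂ V := fun x => LinearMap.ker (f x.1) ⊓ LinearMap.ker (f x.2) with hF
    rw [← Finset.sum_fiberwise_of_maps_to (g := F) (t := Finset.image F {x | x.1 ≠ x.2})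
      (fun x hx => Finset.mem_image_of_mem _ hx)]
    refine sum_mem fun X hX => ?_
    obtain ⟨⟨g, h⟩, hgh, rfl⟩ := Finset.mem_image.1 hX
    have hgh : g ≠ h := (Finset.mem_filter.1 hgh).2
    convert flatPart_mul_flatPart_mem hf rfl (hall g h hgh) using 1
    rw [flatPart, flatPart, Finset.sum_mul_sum, ← Finset.sum_product', Finset.filter_filter]
    refine Finset.sum_subset_zero_on_sdiff ?_ ?_ fun _ _ => rfl
    · rintro ⟨i, j⟩ hij
      simp only [Finset.mem_filter, Finset.mem_univ, true_and, hF] at hij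
      simp only [Finset.mem_product, Finset.mem_filter, Finset.mem_univ, true_and, ← hij.2]
      exact ⟨inf_le_left, inf_le_right⟩
    · rintro ⟨i, j⟩ hij
      simp only [Finset.mem_sdiff, Finset.mem_product, Finset.mem_filter, Finset.mem_univ,
        true_and, hF, not_and] at hij
      by_cases h' : i = j
      · rw [h', smul_mul_smul_comm, osGen_mul_self, smul_zero]
      · exact absurd (inf_ker_eq_of_le hf h' hij.1.1 hij.1.2) (hij.2 h')

theorem mem_osGraded_zero {x : OSAlgebra K f} :
    x ∈ osGraded K f 0 ↔ ∃ c : K, x = c • 1 := by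
  rw [osGraded, ExteriorAlgebra.exteriorPower, pow_zero, Submodule.mem_map]
  constructor
  · rintro ⟨y, hy, rfl⟩
    obtain ⟨c, rfl⟩ := Submodule.mem_one.1 hy
    exact ⟨c, by simp [Algebra.algebraMap_eq_smul_one]⟩
  · rintro ⟨c, rfl⟩
    exact ⟨c • 1, Submodule.smul_mem _ _ (Submodule.one_le.1 le_rfl), by simp⟩

theorem mem_osGraded_one {x : OSAlgebra K f} :
    x ∈ osGraded K f 1 ↔ ∃ w, x = osDegOne K f w := by
  rw [osGraded, ExteriorAlgebra.exteriorPower, pow_one, Submodule.mem_map]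
  constructor
  · rintro ⟨_, ⟨w, rfl⟩, rfl⟩
    exact ⟨w, rfl⟩
  · rintro ⟨w, rfl⟩
    exact ⟨_, ⟨w, rfl⟩, rfl⟩

/-- Resonance in degree one: `u` is resonant if and only if there is a second vector, not
proportional to `u`, whose product with `u` vanishes locally at each rank two flat. -/
theorem mem_resonanceVariety_iff (hf : ∀ i j, LinearIndepOn ℂ f {i, j}) (u : ι → K) :
    u ∈ resonanceVariety K f ↔ ∃ w : ι → K, (∀ c : K, w ≠ c • u) ∧
      ∀ g h, g ≠ h → ∀ k, LinearMap.ker (f g) ⊓ LinearMap.ker (f h) ≤ LinearMap.ker (f k) →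
        w k * flatSum K f (LinearMap.ker (f g) ⊓ LinearMap.ker (f h)) u =
          u k * flatSum K f (LinearMap.ker (f g) ⊓ LinearMap.ker (f h)) w := by
  simp only [← osDegOne_mul_eq_zero_iff hf]
  rw [resonanceVariety, Set.mem_ofPred_eq, Submodule.Quotient.nontrivial_iff, Ne,
    Submodule.submoduleOf_eq_top, SetLike.not_le_iff_exists]
  have hlin : ∀ (c : K) (v : ι → K), osDegOne K f (c • v) = c • osDegOne K f v := by
    intro c v
    simp [osDegOne]
  have hsub : ∀ v v' : ι → K, osDegOne K f (v - v') = osDegOne K f v - osDegOne K f v' := by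
    intro c v
    simp [osDegOne]
  have hcob : ∀ w : ι → K, osDegOne K f w ∈ aomotoCoboundaries (osGraded K f) (osDegOne K f u) ↔
      ∃ c : K, w = c • u := by
    intro w
    rw [aomotoCoboundaries, Submodule.mem_map]
    constructor
    · rintro ⟨y, hy, hyw⟩
      obtain ⟨c, rfl⟩ := mem_osGraded_zero.1 hy
      refine ⟨c, sub_eq_zero.1 ((osDegOne_eq_zero_iff hf _).1 ?_)⟩
      rw [hsub, hlin, ← hyw]
      simp
    · rintro ⟨c, rfl⟩
      exact ⟨c • 1, mem_osGraded_zero.2 ⟨c, rfl⟩, by simp [hlin]⟩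
  constructor
  · rintro ⟨x, hx, hx'⟩
    obtain ⟨h1, h2⟩ := Submodule.mem_inf.1 hx
    obtain ⟨w, rfl⟩ := mem_osGraded_one.1 h1
    rw [hcob] at hx'
    exact ⟨w, fun c hc => hx' ⟨c, hc⟩, h2⟩
  · rintro ⟨w, hw, h⟩
    refine ⟨osDegOne K f w, Submodule.mem_inf.2 ⟨mem_osGraded_one.2 ⟨w, rfl⟩, h⟩, ?_⟩
    rw [hcob]
    rintro ⟨c, hc⟩
    exact hw c hc

end Resonance

/-! ### Rank two flats of the arrangement of type D -/

namespace TypeD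

variable {n : ℕ}

/-- The hyperplane `x_p = τ x_q` for distinct indices `p` and `q` in any order.  With this sign, the
third hyperplane through the intersection of `x_p = σ x_q` and `x_p = τ x_r` is
`x_q = σ τ x_r`. -/
def hyp (p q : Fin n) (h : p ≠ q) (τ : ℤˣ) : Hyp n :=
  if hlt : p < q then ⟨(p, q, -τ), hlt⟩ else ⟨(q, p, -τ), lt_of_le_of_ne (not_lt.1 hlt) h.symm⟩

theorem hyp_of_lt {p q : Fin n} (h : p < q) (τ : ℤˣ) : hyp p q h.ne τ = ⟨(p, q, -τ), h⟩ := by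
  rw [hyp, dif_pos h]

theorem hyp_comm {p q : Fin n} (h : p ≠ q) (τ : ℤˣ) : hyp p q h τ = hyp q p h.symm τ := by
  rcases lt_or_gt_of_ne h with h' | h'
  · rw [hyp, dif_pos h', hyp, dif_neg h'.not_gt]
  · rw [hyp, dif_neg h'.not_gt, hyp, dif_pos h']

theorem exists_eq_hyp (g : Hyp n) : ∃ (p q : Fin n) (h : p < q) (τ : ℤˣ), g = hyp p q h.ne τ := by
  obtain ⟨⟨p, q, s⟩, h⟩ := g
  exact ⟨p, q, h, -s, by rw [hyp_of_lt, neg_neg]⟩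

theorem hyp_eq_hyp_iff {p q p' q' : Fin n} (h : p ≠ q) (h' : p' ≠ q') (τ τ' : ℤˣ) :
    hyp p q h τ = hyp p' q' h' τ' ↔ (p = p' ∧ q = q' ∨ p = q' ∧ q = p') ∧ τ = τ' := by
  unfold hyp
  split_ifs <;> simp only [Subtype.mk.injEq, Prod.mk.injEq, neg_inj] <;>
  constructor <;> intro H <;> grind

theorem sign_ne_zero (τ : ℤˣ) : ((τ : ℤ) : ℂ) ≠ 0 :=
  Int.cast_ne_zero.2 τ.ne_zero

theorem form_hyp {p q : Fin n} (h : p ≠ q) (τ : ℤˣ) (x : Fin n → ℂ) :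
    form (hyp p q h τ) x = 0 ↔ x p = ((τ : ℤ) : ℂ) * x q := by
  unfold hyp form
  split_ifs <;> rcases Int.units_eq_one_or τ with rfl | rfl <;> simp <;> grind

/-- Distinct hyperplanes of the arrangement are different as subspaces. -/
theorem exists_form_eq_zero_ne_zero {g h : Hyp n} (hgh : g ≠ h) :
    ∃ x, form g x = 0 ∧ form h x ≠ 0 := by
  obtain ⟨p, q, hpq, τ, rfl⟩ := exists_eq_hyp g
  obtain ⟨a, b, hab, σ, rfl⟩ := exists_eq_hyp h
  simp only [Ne, form_hyp]
  by_cases ha : a ≠ p ∧ a ≠ q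
  · exact ⟨Pi.single a 1, by simp [ha.1.symm, ha.2.symm],
      by simp [hab.ne']⟩
  by_cases hb : b ≠ p ∧ b ≠ q
  · exact ⟨Pi.single b 1, by simp [hb.1.symm, hb.2.symm],
      by simpa [hab.ne] using (sign_ne_zero σ).symm⟩
  have hpa : a = p ∧ b = q := by grind
  obtain ⟨rfl, rfl⟩ := hpa
  have hτσ : τ ≠ σ := fun h => hgh (by rw [h])
  refine ⟨fun i => if i = a then ((τ : ℤ) : ℂ) else 1, by simp [hab.ne'], ?_⟩
  simp only [if_true, if_neg hab.ne', mul_one, Int.cast_inj, Units.val_inj]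
  exact hτσ

theorem form_ne_zero (g : Hyp n) : form g ≠ 0 := by
  obtain ⟨p, q, hpq, τ, rfl⟩ := exists_eq_hyp g
  intro h
  have h1 := (form_hyp hpq.ne τ (Pi.single p 1)).1 (by rw [h]; rfl)
  simp [hpq.ne'] at h1

theorem linearIndepOn_form_pair (g h : Hyp n) : LinearIndepOn ℂ form {g, h} := by
  by_cases hgh : g = h
  · subst hgh
    simpa using form_ne_zero g
  · rw [LinearIndepOn.pair_iff form hgh]
    intro a b hab
    obtain ⟨x, hx, hx'⟩ := exists_form_eq_zero_ne_zero hgh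
    obtain ⟨y, hy, hy'⟩ := exists_form_eq_zero_ne_zero (Ne.symm hgh)
    have h1 := LinearMap.congr_fun hab x
    have h2 := LinearMap.congr_fun hab y
    simp [hx, hx'] at h1
    simp [hy, hy'] at h2
    exact ⟨h2, h1⟩

theorem flat_adjacent {p q r : Fin n} (hpq : p ≠ q) (hpr : p ≠ r) (hqr : q ≠ r) (σ τ : ℤˣ)
    (k : Hyp n) :
    LinearMap.ker (form (hyp p q hpq σ)) ⊓ LinearMap.ker (form (hyp p r hpr τ)) ≤
        LinearMap.ker (form k) ↔
      k = hyp p q hpq σ ∨ k = hyp p r hpr τ ∨ k = hyp q r hqr (σ * τ) := by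
  have hσ : ((σ : ℤ) : ℂ) * ((σ : ℤ) : ℂ) = 1 := by
    rcases Int.units_eq_one_or σ with rfl | rfl <;> simp
  have hτ : ((τ : ℤ) : ℂ) * ((τ : ℤ) : ℂ) = 1 := by
    rcases Int.units_eq_one_or τ with rfl | rfl <;> simp
  constructor
  · intro hle
    obtain ⟨a, b, hab, ρ, rfl⟩ := exists_eq_hyp k
    have key : ∀ x : Fin n → ℂ, x p = ((σ : ℤ) : ℂ) * x q → x p = ((τ : ℤ) : ℂ) * x r →
        x a = ((ρ : ℤ) : ℂ) * x b := by
      intro x h1 h2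
      rw [← form_hyp hab.ne]
      exact hle ⟨(form_hyp hpq σ x).2 h1, (form_hyp hpr τ x).2 h2⟩
    have ha : a = p ∨ a = q ∨ a = r := by
      by_contra! h
      have := key (Pi.single a 1) (by simp [h.1.symm, h.2.1.symm])
        (by simp [h.1.symm, h.2.2.symm])
      simp [hab.ne'] at this
    have hb : b = p ∨ b = q ∨ b = r := by
      by_contra! h
      have := key (Pi.single b 1) (by simp [h.1.symm, h.2.1.symm])
        (by simp [h.1.symm, h.2.2.symm])
      simp only [Pi.single_eq_same, Pi.single_eq_of_ne hab.ne, mul_one] at this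
      exact sign_ne_zero ρ this.symm
    -- a point of the flat which determines the sign of the hyperplane
    have hx := key (fun i => if i = p then 1 else if i = q then ((σ : ℤ) : ℂ)
      else ((τ : ℤ) : ℂ)) (by simp [hpq.symm, hσ]) (by simp [hpr.symm, hqr.symm, hτ])
    simp only [hyp_eq_hyp_iff]
    rcases Int.units_eq_one_or σ with rfl | rfl <;> rcases Int.units_eq_one_or τ with rfl | rfl <;>
      rcases Int.units_eq_one_or ρ with rfl | rfl <;> rcases ha with rfl | rfl | rfl <;>
      rcases hb with rfl | rfl | rfl <;>
      first
      | exact absurd rfl hab.ne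
      | (revert hx; norm_num [hpq, hpr, hqr, hpq.symm, hpr.symm, hqr.symm])
  · rintro (rfl | rfl | rfl)
    · exact inf_le_left
    · exact inf_le_right
    · rintro x ⟨h1, h2⟩
      have h1 := (form_hyp hpq σ x).1 h1
      have h2 := (form_hyp hpr τ x).1 h2
      refine (form_hyp hqr (σ * τ) x).2 ?_
      push_cast
      linear_combination (((σ : ℤ) : ℂ)) * h2 - ((σ : ℤ) : ℂ) * h1 - x q * hσ

theorem flat_disjoint {p q r l : Fin n} (hpq : p ≠ q) (hrl : r ≠ l) (hpr : p ≠ r) (hpl : p ≠ l)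
    (hqr : q ≠ r) (hql : q ≠ l) (σ τ : ℤˣ) (k : Hyp n) :
    LinearMap.ker (form (hyp p q hpq σ)) ⊓ LinearMap.ker (form (hyp r l hrl τ)) ≤
        LinearMap.ker (form k) ↔
      k = hyp p q hpq σ ∨ k = hyp r l hrl τ := by
  constructor
  · intro hle
    obtain ⟨a, b, hab, ρ, rfl⟩ := exists_eq_hyp k
    have key : ∀ x : Fin n → ℂ, x p = ((σ : ℤ) : ℂ) * x q → x r = ((τ : ℤ) : ℂ) * x l →
        x a = ((ρ : ℤ) : ℂ) * x b := by
      intro x h1 h2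
      rw [← form_hyp hab.ne]
      exact hle ⟨(form_hyp hpq σ x).2 h1, (form_hyp hrl τ x).2 h2⟩
    have ha : a = p ∨ a = q ∨ a = r ∨ a = l := by
      by_contra! h
      have := key (Pi.single a 1) (by simp [h.1.symm, h.2.1.symm])
        (by simp [h.2.2.1.symm, h.2.2.2.symm])
      simp [hab.ne'] at this
    have hb : b = p ∨ b = q ∨ b = r ∨ b = l := by
      by_contra! h
      have := key (Pi.single b 1) (by simp [h.1.symm, h.2.1.symm])
        (by simp [h.2.2.1.symm, h.2.2.2.symm])
      simp only [Pi.single_eq_same, Pi.single_eq_of_ne hab.ne, mul_one] at this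
      exact sign_ne_zero ρ this.symm
    have hx := key (fun i => if i = p then ((σ : ℤ) : ℂ) else if i = q then 1 else 0)
      (by simp [hpq.symm]) (by simp [hpr.symm, hqr.symm, hpl.symm, hql.symm])
    have hy := key (fun i => if i = r then ((τ : ℤ) : ℂ) else if i = l then 1 else 0)
      (by simp [hpr, hpl, hqr, hql]) (by simp [hrl.symm])
    simp only [hyp_eq_hyp_iff]
    rcases Int.units_eq_one_or σ with rfl | rfl <;> rcases Int.units_eq_one_or τ with rfl | rfl <;>
      rcases Int.units_eq_one_or ρ with rfl | rfl <;> rcases ha with rfl | rfl | rfl | rfl <;>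
      rcases hb with rfl | rfl | rfl | rfl <;>
      first
      | exact absurd rfl hab.ne
      | (revert hx hy
         norm_num [hpq, hrl, hpr, hpl, hqr, hql, hpq.symm, hrl.symm, hpr.symm, hpl.symm, hqr.symm,
          hql.symm])
  · rintro (rfl | rfl)
    · exact inf_le_left
    · exact inf_le_right

theorem flat_opposite {p q : Fin n} (hpq : p ≠ q) {σ τ : ℤˣ} (hστ : σ ≠ τ) (k : Hyp n) :
    LinearMap.ker (form (hyp p q hpq σ)) ⊓ LinearMap.ker (form (hyp p q hpq τ)) ≤
        LinearMap.ker (form k) ↔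
      k = hyp p q hpq σ ∨ k = hyp p q hpq τ := by
  constructor
  · intro hle
    obtain ⟨a, b, hab, ρ, rfl⟩ := exists_eq_hyp k
    have key : ∀ x : Fin n → ℂ, x p = 0 → x q = 0 → x a = ((ρ : ℤ) : ℂ) * x b := by
      intro x h1 h2
      rw [← form_hyp hab.ne]
      exact hle ⟨(form_hyp hpq σ x).2 (by simp [h1, h2]), (form_hyp hpq τ x).2 (by simp [h1, h2])⟩
    have ha : a = p ∨ a = q := by
      by_contra! h
      have := key (Pi.single a 1) (by simp [h.1.symm])
        (by simp [h.2.symm])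
      simp [hab.ne'] at this
    have hb : b = p ∨ b = q := by
      by_contra! h
      have := key (Pi.single b 1) (by simp [h.1.symm])
        (by simp [h.2.symm])
      simp only [Pi.single_eq_same, Pi.single_eq_of_ne hab.ne, mul_one] at this
      exact sign_ne_zero ρ this.symm
    have hρ : ρ = σ ∨ ρ = τ := by
      rcases Int.units_eq_one_or σ with rfl | rfl <;>
        rcases Int.units_eq_one_or τ with rfl | rfl <;>
        rcases Int.units_eq_one_or ρ with rfl | rfl <;> simp_all
    simp only [hyp_eq_hyp_iff]
    have := hab.ne
    grind
  · rintro (rfl | rfl)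
    · exact inf_le_left
    · exact inf_le_right

/-- Two hyperplanes on index pairs `{p, q}` and `{p, r}`, together with the third hyperplane
containing their intersection. -/
def IsTriangle (g h k : Hyp n) : Prop :=
  ∃ (p q r : Fin n) (hpq : p ≠ q) (hpr : p ≠ r) (hqr : q ≠ r) (σ τ : ℤˣ),
    g = hyp p q hpq σ ∧ h = hyp p r hpr τ ∧ k = hyp q r hqr (σ * τ)

/-- Two hyperplanes whose pairs of indices are equal or disjoint; if they are distinct, no third
hyperplane contains their intersection. -/
def IsOrthogonal (g h : Hyp n) : Prop :=
  (∃ (p q : Fin n) (hpq : p ≠ q) (σ τ : ℤˣ), g = hyp p q hpq σ ∧ h = hyp p q hpq τ) ∨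
    ∃ (p q r l : Fin n) (hpq : p ≠ q) (hrl : r ≠ l) (σ τ : ℤˣ), p ≠ r ∧ p ≠ l ∧ q ≠ r ∧ q ≠ l ∧
      g = hyp p q hpq σ ∧ h = hyp r l hrl τ

theorem isOrthogonal_or_exists_isTriangle (g h : Hyp n) :
    IsOrthogonal g h ∨ ∃ k, IsTriangle g h k := by
  obtain ⟨p, q, hpq, σ, rfl⟩ := exists_eq_hyp g
  obtain ⟨r, l, hrl, τ, rfl⟩ := exists_eq_hyp h
  have h1 := hpq.ne
  have h2 := hrl.ne
  by_cases hpr : p = r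
  · subst hpr
    by_cases hql : q = l
    · subst hql
      exact .inl (.inl ⟨_, _, h1, σ, τ, rfl, rfl⟩)
    · exact .inr ⟨_, p, q, l, h1, h2, hql, σ, τ, rfl, rfl, rfl⟩
  by_cases hql : q = l
  · subst hql
    exact .inr ⟨_, q, p, r, h1.symm, h2.symm, hpr, σ, τ, hyp_comm _ _, hyp_comm _ _, rfl⟩
  by_cases hpl : p = l
  · subst hpl
    exact .inr ⟨_, p, q, r, h1, h2.symm, (hrl.trans hpq).ne', σ, τ, rfl, hyp_comm _ _, rfl⟩
  by_cases hqr : q = r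
  · subst hqr
    exact .inr ⟨_, q, p, l, h1.symm, h2, hpl, σ, τ, hyp_comm _ _, rfl, rfl⟩
  exact .inl (.inr ⟨p, q, r, l, h1, h2, σ, τ, hpr, hpl, hqr, hql, rfl, rfl⟩)

theorem IsTriangle.swap {g h k : Hyp n} (H : IsTriangle g h k) : IsTriangle h g k := by
  obtain ⟨p, q, r, hpq, hpr, hqr, σ, τ, rfl, rfl, rfl⟩ := H
  exact ⟨p, r, q, hpr, hpq, hqr.symm, τ, σ, rfl, rfl, by rw [hyp_comm, mul_comm]⟩

theorem IsTriangle.rotate {g h k : Hyp n} (H : IsTriangle g h k) : IsTriangle h k g := by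
  obtain ⟨p, q, r, hpq, hpr, hqr, σ, τ, rfl, rfl, rfl⟩ := H
  refine ⟨r, p, q, hpr.symm, hqr.symm, hpq, τ, σ * τ, hyp_comm _ _, hyp_comm _ _, ?_⟩
  rw [mul_left_comm, Int.units_mul_self, mul_one]

theorem IsTriangle.ne {g h k : Hyp n} (H : IsTriangle g h k) : g ≠ h := by
  obtain ⟨p, q, r, hpq, hpr, hqr, σ, τ, rfl, rfl, rfl⟩ := H
  rw [Ne, hyp_eq_hyp_iff]
  grind

theorem IsTriangle.le_ker_iff {g h k : Hyp n} (H : IsTriangle g h k) (m : Hyp n) :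
    LinearMap.ker (form g) ⊓ LinearMap.ker (form h) ≤ LinearMap.ker (form m) ↔
      m = g ∨ m = h ∨ m = k := by
  obtain ⟨p, q, r, hpq, hpr, hqr, σ, τ, rfl, rfl, rfl⟩ := H
  exact flat_adjacent hpq hpr hqr σ τ m

theorem IsOrthogonal.le_ker_iff {g h : Hyp n} (H : IsOrthogonal g h) (hgh : g ≠ h) (m : Hyp n) :
    LinearMap.ker (form g) ⊓ LinearMap.ker (form h) ≤ LinearMap.ker (form m) ↔
      m = g ∨ m = h := by
  rcases H with ⟨p, q, hpq, σ, τ, rfl, rfl⟩ | ⟨p, q, r, l, hpq, hrl, σ, τ, hpr, hpl, hqr, hql,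
    rfl, rfl⟩
  · exact flat_opposite hpq (fun h => hgh (by rw [h])) m
  · exact flat_disjoint hpq hrl hpr hpl hqr hql σ τ m

theorem IsTriangle.flatSum_eq {K : Type*} [Field K] {g h k : Hyp n} (H : IsTriangle g h k)
    (u : Hyp n → K) :
    flatSum K form (LinearMap.ker (form g) ⊓ LinearMap.ker (form h)) u = u g + u h + u k := by
  classical
  rw [flatSum_apply]
  simp only [H.le_ker_iff]
  have : ({m | m = g ∨ m = h ∨ m = k} : Finset (Hyp n)) = {g, h, k} := by ext; simp
  rw [this, Finset.sum_insert (by simp [H.ne, H.rotate.rotate.ne.symm]),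
    Finset.sum_pair H.rotate.ne, add_assoc]

theorem IsOrthogonal.flatSum_eq {K : Type*} [Field K] {g h : Hyp n} (H : IsOrthogonal g h)
    (hgh : g ≠ h) (u : Hyp n → K) :
    flatSum K form (LinearMap.ker (form g) ⊓ LinearMap.ker (form h)) u = u g + u h := by
  classical
  rw [flatSum_apply]
  simp only [H.le_ker_iff hgh]
  have : ({m | m = g ∨ m = h} : Finset (Hyp n)) = {g, h} := by ext; simp
  rw [this, Finset.sum_pair hgh]

/-- The local conditions for resonance in the arrangement of type D. -/
theorem mem_resonanceVariety_form_iff {K : Type*} [Field K] (u : Hyp n → K) :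
    u ∈ resonanceVariety K (form (n := n)) ↔ ∃ w : Hyp n → K, (∀ c : K, w ≠ c • u) ∧
      (∀ g h, IsOrthogonal g h → w g * u h = u g * w h) ∧
      ∀ g h k, IsTriangle g h k → w g * (u g + u h + u k) = u g * (w g + w h + w k) := by
  rw [mem_resonanceVariety_iff linearIndepOn_form_pair]
  refine exists_congr fun w => and_congr_right fun _ => ⟨fun H => ⟨?_, ?_⟩, ?_⟩
  · intro g h hgh
    by_cases hne : g = h
    · rw [hne, mul_comm]
    have := H g h hne g inf_le_left
    rw [hgh.flatSum_eq hne, hgh.flatSum_eq hne] at this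
    linear_combination this
  · intro g h k hghk
    have := H g h hghk.ne g inf_le_left
    rwa [hghk.flatSum_eq, hghk.flatSum_eq] at this
  · rintro ⟨H1, H2⟩ g h hgh m hm
    rcases isOrthogonal_or_exists_isTriangle g h with hort | ⟨k, hk⟩
    · rw [hort.flatSum_eq hgh, hort.flatSum_eq hgh]
      have := H1 g h hort
      rcases (hort.le_ker_iff hgh m).1 hm with rfl | rfl
      · linear_combination this
      · linear_combination -this
    · rw [hk.flatSum_eq, hk.flatSum_eq]
      rcases (hk.le_ker_iff m).1 hm with rfl | rfl | rfl
      · exact H2 _ _ _ hk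
      · linear_combination H2 _ _ _ hk.rotate
      · linear_combination H2 _ _ _ hk.rotate.rotate

end TypeD

/-! ### Resonant labellings of signed complete graphs -/

section Labelling

/-- The determinant of two vectors of the plane. -/
def planeDet {K : Type*} [Field K] (x y : K × K) : K := x.1 * y.2 - x.2 * y.1

variable {K : Type*} [Field K]

theorem planeDet_swap_eq_zero {x y : K × K} (h : planeDet x y = 0) : planeDet y x = 0 := by
  unfold planeDet at *
  linear_combination -h

theorem planeDet_swap_ne_zero {x y : K × K} (h : planeDet x y ≠ 0) : planeDet y x ≠ 0 :=
  fun h' => h (planeDet_swap_eq_zero h')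

theorem planeDet_self (x : K × K) : planeDet x x = 0 := by
  unfold planeDet
  ring

theorem ne_zero_of_planeDet {x y : K × K} (h : planeDet x y ≠ 0) : x ≠ 0 := by
  rintro rfl
  simp [planeDet] at h

theorem eq_zero_of_planeDet {x a b : K × K} (hab : planeDet a b ≠ 0) (ha : planeDet x a = 0)
    (hb : planeDet x b = 0) : x = 0 := by
  unfold planeDet at *
  refine Prod.ext ?_ ?_
  · refine (mul_eq_zero.1 (?_ : (a.1 * b.2 - a.2 * b.1) * x.1 = 0)).resolve_left hab
    linear_combination a.1 * hb - b.1 * ha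
  · refine (mul_eq_zero.1 (?_ : (a.1 * b.2 - a.2 * b.1) * x.2 = 0)).resolve_left hab
    linear_combination a.2 * hb - b.2 * ha

/-- The vector `x` spans the same line as the nonzero vector `a`. -/
def SameLine (x a : K × K) : Prop := x ≠ 0 ∧ planeDet x a = 0

theorem SameLine.planeDet_ne_zero {x y a b : K × K} (hx : SameLine x a) (hy : SameLine y b)
    (hab : planeDet a b ≠ 0) : planeDet x y ≠ 0 := by
  intro hxy
  by_cases h : planeDet x b = 0
  · exact hx.1 (eq_zero_of_planeDet hab hx.2 h)
  · exact hy.1 (eq_zero_of_planeDet h (planeDet_swap_eq_zero hxy) hy.2)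

theorem planeDet_ne_zero_of_add_eq_zero {x y z : K × K} (h : x + y + z = 0)
    (hxy : planeDet x y ≠ 0) : planeDet y z ≠ 0 ∧ planeDet z x ≠ 0 := by
  have hz : z = -(x + y) := eq_neg_of_add_eq_zero_right h
  subst hz
  constructor
  · intro h
    apply hxy
    unfold planeDet at *
    simp at *
    linear_combination h
  · intro h
    apply hxy
    unfold planeDet at *
    simp at *
    linear_combination h

/-- A labelling of the hyperplanes `x_p = τ x_q` by vectors in the plane, such that the labels of
the hyperplanes through each rank two flat are pairwise proportional or have sum zero. -/
structure IsResonantLabelling {α : Type*} (V : α → α → ℤˣ → K × K) : Prop where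
  symm : ∀ p q, p ≠ q → ∀ τ, V p q τ = V q p τ
  opposite : ∀ p q, p ≠ q → ∀ σ τ, planeDet (V p q σ) (V p q τ) = 0
  disjoint : ∀ p q r l, p ≠ q → r ≠ l → p ≠ r → p ≠ l → q ≠ r → q ≠ l → ∀ σ τ,
    planeDet (V p q σ) (V r l τ) = 0
  triangle : ∀ p q r, p ≠ q → p ≠ r → q ≠ r → ∀ σ τ,
    planeDet (V p q σ) (V p q σ + V p r τ + V q r (σ * τ)) = 0

/-- The labels on the balanced edges of the vertex set `T`, with signs given by the switching
function `ε`, are not proportional for adjacent edges. -/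
def IsRainbow {α : Type*} (V : α → α → ℤˣ → K × K) (T : Finset α) (ε : α → ℤˣ) : Prop :=
  ∀ p ∈ T, ∀ q ∈ T, ∀ r ∈ T, p ≠ q → p ≠ r → q ≠ r →
    planeDet (V p q (ε p * ε q)) (V p r (ε p * ε r)) ≠ 0

namespace IsResonantLabelling

variable {α : Type*} {V : α → α → ℤˣ → K × K}

theorem sum_eq_zero (hV : IsResonantLabelling V) {p q r : α} (hpq : p ≠ q) (hpr : p ≠ r)
    (hqr : q ≠ r) {σ τ : ℤˣ} (h : planeDet (V p q σ) (V p r τ) ≠ 0) :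
    V p q σ + V p r τ + V q r (σ * τ) = 0 := by
  refine eq_zero_of_planeDet h (planeDet_swap_eq_zero (hV.triangle p q r hpq hpr hqr σ τ))
    (planeDet_swap_eq_zero ?_)
  have := hV.triangle p r q hpr hpq hqr.symm τ σ
  rwa [hV.symm r q hqr.symm, mul_comm τ σ, add_comm (V p r τ)] at this

variable [DecidableEq α]

theorem exists_isRainbow_triple (hV : IsResonantLabelling V) {p q r : α} (hpq : p ≠ q)
    (hpr : p ≠ r) (hqr : q ≠ r) {σ τ : ℤˣ} (h : planeDet (V p q σ) (V p r τ) ≠ 0) :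
    ∃ ε, IsRainbow V {p, q, r} ε := by
  obtain ⟨h1, h2⟩ := planeDet_ne_zero_of_add_eq_zero (hV.sum_eq_zero hpq hpr hqr h) h
  refine ⟨fun i => if i = p then 1 else if i = q then σ else τ, ?_⟩
  have e1 := hV.symm p q hpq
  have e2 := hV.symm p r hpr
  have e3 := hV.symm q r hqr
  intro a ha b hb c hc hab hac hbc
  simp only [Finset.mem_insert, Finset.mem_singleton] at ha hb hc
  rcases ha with rfl | rfl | rfl <;> rcases hb with rfl | rfl | rfl <;>
    rcases hc with rfl | rfl | rfl <;>
    first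
    | exact absurd rfl hab
    | exact absurd rfl hac
    | exact absurd rfl hbc
    | (simp only [hpq, hpq.symm, hpr.symm, hqr.symm, if_true, if_false, one_mul, mul_one,
        ← e1, ← e2, ← e3, mul_comm τ σ]
       first
       | assumption
       | (apply planeDet_swap_ne_zero; assumption))

/-- An edge disjoint from three vertices of a rainbow graph has label zero, being proportional to
two independent labels. -/
theorem eq_zero_of_isRainbow (hV : IsResonantLabelling V) {T : Finset α} {ε : α → ℤˣ}
    (hT : IsRainbow V T ε) {a b : α} (hab : a ≠ b) (ha : a ∉ T) (hb : 2 < (T.erase b).card)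
    (τ : ℤˣ) : V a b τ = 0 := by
  obtain ⟨x, hx, y, hy, z, hz, hxy, hxz, hyz⟩ := Finset.two_lt_card.1 hb
  rw [Finset.mem_erase] at hx hy hz
  have hne : ∀ w ∈ T, a ≠ w := fun w hw h => ha (h ▸ hw)
  refine eq_zero_of_planeDet (hT x hx.2 y hy.2 z hz.2 hxy hxz hyz) ?_ ?_
  · exact hV.disjoint a b x y hab hxy (hne x hx.2) (hne y hy.2) hx.1.symm hy.1.symm _ _
  · exact hV.disjoint a b x z hab hxz (hne x hx.2) (hne z hz.2) hx.1.symm hz.1.symm _ _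

/-- A rainbow triangle together with an edge with nonzero label leaving it generate a rainbow
complete graph on four vertices. -/
theorem exists_isRainbow_insert (hV : IsResonantLabelling V) {T : Finset α} {ε : α → ℤˣ}
    (hT : IsRainbow V T ε) (hcard : T.card = 3) {p l : α} (hp : p ∈ T) (hl : l ∉ T) {u : ℤˣ}
    (hu : V p l u ≠ 0) : ∃ ε', IsRainbow V (insert l T) ε' := by
  obtain ⟨q, r, hqr, hqrT⟩ := Finset.card_eq_two.1
    (show (T.erase p).card = 2 by rw [Finset.card_erase_of_mem hp, hcard])
  have hTeq : T = {p, q, r} := by rw [← hqrT, Finset.insert_erase hp]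
  have hpq : p ≠ q := by
    have : q ∈ T.erase p := by simp [hqrT]
    exact (Finset.mem_erase.1 this).1.symm
  have hpr : p ≠ r := by
    have : r ∈ T.erase p := by simp [hqrT]
    exact (Finset.mem_erase.1 this).1.symm
  subst hTeq
  simp only [Finset.mem_insert, Finset.mem_singleton, not_or] at hl
  obtain ⟨hlp, hlq, hlr⟩ := hl
  -- the switching function is extended so that the given edge becomes balanced
  set ε' := Function.update ε l (u * ε p) with hε'
  have hεp : ε' p = ε p := Function.update_of_ne (Ne.symm hlp) _ _
  have hεq : ε' q = ε q := Function.update_of_ne (Ne.symm hlq) _ _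
  have hεr : ε' r = ε r := Function.update_of_ne (Ne.symm hlr) _ _
  have hεl : ε' l = u * ε p := Function.update_self _ _ _
  obtain ⟨X, hX⟩ : ∃ X : α → α → K × K, ∀ a b, X a b = V a b (ε' a * ε' b) := ⟨_, fun _ _ => rfl⟩
  have hsymm : ∀ a b, a ≠ b → X a b = X b a := by
    intro a b hab
    rw [hX, hX, hV.symm a b hab, mul_comm]
  have hdet1 : planeDet (X p q) (X p r) ≠ 0 := by
    have := hT p (by simp) q (by simp) r (by simp) hpq hpr hqr
    rwa [hX, hX, hεp, hεq, hεr]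
  have hdet2 : planeDet (X q p) (X q r) ≠ 0 := by
    have := hT q (by simp) p (by simp) r (by simp) hpq.symm hqr hpr
    rwa [hX, hX, hεp, hεq, hεr]
  have hdet3 : planeDet (X r p) (X r q) ≠ 0 := by
    have := hT r (by simp) p (by simp) q (by simp) hpr.symm hqr.symm hpq
    rwa [hX, hX, hεp, hεq, hεr]
  rw [hsymm q p hpq.symm] at hdet2
  rw [hsymm r p hpr.symm, hsymm r q hqr.symm] at hdet3
  have hpl : X p l = V p l u := by
    rw [hX, hεp, hεl, mul_left_comm, Int.units_mul_self, mul_one]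
  have sl3 : SameLine (X p l) (X q r) := by
    refine ⟨hpl ▸ hu, ?_⟩
    rw [hX, hX]
    exact hV.disjoint p l q r (Ne.symm hlp) hqr hpq hpr hlq hlr _ _
  have sl_self : ∀ a b c d, planeDet (X a b) (X c d) ≠ 0 → SameLine (X a b) (X a b) :=
    fun a b c d h => ⟨ne_zero_of_planeDet h, planeDet_self _⟩
  have sl1' := sl_self _ _ _ _ hdet1
  have sl2' := sl_self _ _ _ _ hdet3
  have sl3' := sl_self _ _ _ _ (planeDet_swap_ne_zero hdet2)
  -- the triangle on `p`, `a`, `l` transports the nonzero label to the edge `{a, l}`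
  have step : ∀ a b, p ≠ a → l ≠ a → a ≠ b → l ≠ b → p ≠ b →
      planeDet (X p a) (X p l) ≠ 0 → SameLine (X a l) (X p b) := by
    intro a b hpa hla hab hlb hpb hdet
    constructor
    · have hs : X p a + X p l + X a l = 0 := by
        have e : ε' a * ε' l = ε' p * ε' a * (ε' p * ε' l) := by
          rw [mul_mul_mul_comm, Int.units_mul_self, one_mul]
        rw [hX p a, hX p l] at hdet
        rw [hX p a, hX p l, hX a l, e]
        exact hV.sum_eq_zero hpa (Ne.symm hlp) (Ne.symm hla) hdet
      exact ne_zero_of_planeDet (planeDet_ne_zero_of_add_eq_zero hs hdet).2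
    · rw [hX, hX]
      exact hV.disjoint a l p b (Ne.symm hla) hpb (Ne.symm hpa) hab hlp hlb _ _
  have sl2 : SameLine (X q l) (X p r) :=
    step q r hpq hlq hqr hlr hpr (sl1'.planeDet_ne_zero sl3 hdet2)
  have sl1 : SameLine (X r l) (X p q) :=
    step r q hpr hlr hqr.symm hlq hpq (sl2'.planeDet_ne_zero sl3 hdet3)
  have hdet1s := planeDet_swap_ne_zero hdet1
  have hdet2s := planeDet_swap_ne_zero hdet2
  have hdet3s := planeDet_swap_ne_zero hdet3
  have e1 := hsymm p q hpq
  have e2 := hsymm p r hpr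
  have e3 := hsymm q r hqr
  have e4 := hsymm p l (Ne.symm hlp)
  have e5 := hsymm q l (Ne.symm hlq)
  have e6 := hsymm r l (Ne.symm hlr)
  refine ⟨ε', ?_⟩
  intro a ha b hb c hc hab hac hbc
  rw [← hX, ← hX]
  simp only [Finset.mem_insert, Finset.mem_singleton] at ha hb hc
  rcases ha with rfl | rfl | rfl | rfl <;> rcases hb with rfl | rfl | rfl | rfl <;>
    first
    | exact absurd rfl hab
    | (rcases hc with rfl | rfl | rfl | rfl <;>
        first
        | exact absurd rfl hac
        | exact absurd rfl hbc
        | (try simp only [← e1, ← e2, ← e3, ← e4, ← e5, ← e6]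
           apply SameLine.planeDet_ne_zero <;> assumption))

/-- If a rainbow graph carries a nonzero label on an unbalanced edge `{p, q}`, then the unbalanced
edges at `p` have nonzero labels. -/
theorem ne_zero_of_unbalanced {α : Type*} {V : α → α → ℤˣ → K × K} (hV : IsResonantLabelling V)
    {T : Finset α} {ε : α → ℤˣ} (hT : IsRainbow V T ε) {p q r : α} (hp : p ∈ T) (hq : q ∈ T)
    (hr : r ∈ T) (hpq : p ≠ q) (hpr : p ≠ r) (hqr : q ≠ r) (h : V p q (-(ε p * ε q)) ≠ 0) :
    V p r (-(ε p * ε r)) ≠ 0 := by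
  have hdet := hT q hq p hp r hr hpq.symm hqr hpr
  have hdet' : planeDet (V q p (-(ε q * ε p))) (V q r (ε q * ε r)) ≠ 0 := by
    refine SameLine.planeDet_ne_zero ⟨?_, hV.opposite q p hpq.symm _ (ε q * ε p)⟩
      ⟨ne_zero_of_planeDet (planeDet_swap_ne_zero hdet), planeDet_self _⟩ hdet
    rwa [hV.symm q p hpq.symm, mul_comm]
  have hs := hV.sum_eq_zero hpq.symm hqr hpr hdet'
  have e : -(ε q * ε p) * (ε q * ε r) = -(ε p * ε r) := by
    rw [neg_mul, mul_mul_mul_comm, Int.units_mul_self, one_mul]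
  rw [e] at hs
  exact ne_zero_of_planeDet (planeDet_ne_zero_of_add_eq_zero hs hdet').2

/-- If a rainbow graph carries a nonzero label on some unbalanced edge, then all pairs of adjacent
edges, with any signs, carry labels which are not proportional. -/
theorem planeDet_ne_zero_of_unbalanced {α : Type*} {V : α → α → ℤˣ → K × K}
    (hV : IsResonantLabelling V) {T : Finset α} {ε : α → ℤˣ} (hT : IsRainbow V T ε)
    {p q : α} (hp : p ∈ T) (hq : q ∈ T) (hpq : p ≠ q) (h : V p q (-(ε p * ε q)) ≠ 0)
    {a b c : α} (ha : a ∈ T) (hb : b ∈ T) (hc : c ∈ T) (hab : a ≠ b) (hac : a ≠ c) (hbc : b ≠ c)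
    (σ τ : ℤˣ) : planeDet (V a b σ) (V a c τ) ≠ 0 := by
  have hneg : ∀ x ∈ T, ∀ y ∈ T, x ≠ y → V x y (-(ε x * ε y)) ≠ 0 := by
    have hp' : ∀ x ∈ T, p ≠ x → V p x (-(ε p * ε x)) ≠ 0 := by
      intro x hx hpx
      by_cases hqx : q = x
      · rwa [← hqx]
      · exact hV.ne_zero_of_unbalanced hT hp hq hx hpq hpx hqx h
    have hp'' : ∀ x ∈ T, p ≠ x → V x p (-(ε x * ε p)) ≠ 0 := by
      intro x hx hpx
      rw [hV.symm x p hpx.symm, mul_comm]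
      exact hp' x hx hpx
    intro x hx y hy hxy
    by_cases hpx : p = x
    · subst hpx
      exact hp' y hy hxy
    by_cases hpy : p = y
    · subst hpy
      exact hp'' x hx hpx
    · exact hV.ne_zero_of_unbalanced hT hx hp hy (Ne.symm hpx) hxy hpy (hp'' x hx hpx)
  have hline : ∀ x ∈ T, ∀ y ∈ T, ∀ z ∈ T, x ≠ y → x ≠ z → y ≠ z → ∀ ρ,
      SameLine (V x y ρ) (V x y (ε x * ε y)) := by
    intro x hx y hy z hz hxy hxz hyz ρ
    refine ⟨?_, hV.opposite x y hxy _ _⟩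
    have h1 := ne_zero_of_planeDet (hT x hx y hy z hz hxy hxz hyz)
    have h2 := hneg x hx y hy hxy
    by_cases hρ : ρ = ε x * ε y
    · rwa [hρ]
    · rwa [Int.units_ne_iff_eq_neg.1 hρ]
  exact (hline a ha b hb c hc hab hac hbc σ).planeDet_ne_zero
    (hline a ha c hc b hb hac hab hbc.symm τ) (hT a ha b hb c hc hab hac hbc)

/-- The support of a resonant labelling which is not contained in a line is a balanced complete
graph, or a complete graph with all signs, on three or four vertices. -/
theorem exists_support (hV : IsResonantLabelling V) {p q r : α} (hpq : p ≠ q)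
    (hpr : p ≠ r) (hqr : q ≠ r) {σ τ : ℤˣ} (h : planeDet (V p q σ) (V p r τ) ≠ 0) :
    ∃ T : Finset α, (T.card = 3 ∨ T.card = 4) ∧
      ((∃ ε, IsRainbow V T ε ∧
          ∀ a b, a ≠ b → ∀ u, V a b u ≠ 0 → a ∈ T ∧ b ∈ T ∧ u = ε a * ε b) ∨
        ((∀ a ∈ T, ∀ b ∈ T, ∀ c ∈ T, a ≠ b → a ≠ c → b ≠ c → ∀ σ τ,
            planeDet (V a b σ) (V a c τ) ≠ 0) ∧
          ∀ a b, a ≠ b → ∀ u, V a b u ≠ 0 → a ∈ T ∧ b ∈ T)) := by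
  obtain ⟨T, ε, hcard, hT, hsupp⟩ : ∃ (T : Finset α) (ε : α → ℤˣ), (T.card = 3 ∨ T.card = 4) ∧
      IsRainbow V T ε ∧ ∀ a b, a ≠ b → ∀ u, V a b u ≠ 0 → a ∈ T ∧ b ∈ T := by
    obtain ⟨ε, hT⟩ := hV.exists_isRainbow_triple hpq hpr hqr h
    have hcard : ({p, q, r} : Finset α).card = 3 :=
      Finset.card_eq_three.2 ⟨p, q, r, hpq, hpr, hqr, rfl⟩
    generalize ({p, q, r} : Finset α) = T at hT hcard
    by_cases hl : ∃ a ∈ T, ∃ l, l ∉ T ∧ ∃ u, V a l u ≠ 0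
    · obtain ⟨a, ha, l, hl, u, hu⟩ := hl
      obtain ⟨ε', hT'⟩ := hV.exists_isRainbow_insert hT hcard ha hl hu
      have hcard' : (insert l T).card = 4 := by rw [Finset.card_insert_of_notMem hl, hcard]
      have herase : ∀ b, 2 < ((insert l T).erase b).card := by
        intro b
        have := Finset.pred_card_le_card_erase (s := insert l T) (a := b)
        omega
      have hmem : ∀ a b, a ≠ b → ∀ u, V a b u ≠ 0 → a ∈ insert l T := by
        intro a b hab u hu
        by_contra ha
        exact hu (hV.eq_zero_of_isRainbow hT' hab ha (herase b) u)
      exact ⟨_, ε', .inr hcard', hT', fun a b hab u hu =>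
        ⟨hmem a b hab u hu, hmem b a hab.symm u (by rwa [← hV.symm a b hab])⟩⟩
    · push Not at hl
      have hmem : ∀ a b, a ≠ b → ∀ u, V a b u ≠ 0 → a ∈ T := by
        intro a b hab u hu
        by_contra ha
        by_cases hb : b ∈ T
        · exact hu (by rw [hV.symm a b hab]; exact hl b hb a ha u)
        · exact hu (hV.eq_zero_of_isRainbow hT hab ha (by
            rw [Finset.erase_eq_of_notMem hb, hcard]; omega) u)
      exact ⟨T, ε, .inl hcard, hT, fun a b hab u hu =>
        ⟨hmem a b hab u hu, hmem b a hab.symm u (by rwa [← hV.symm a b hab])⟩⟩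
  refine ⟨T, hcard, ?_⟩
  by_cases hun : ∃ a ∈ T, ∃ b ∈ T, a ≠ b ∧ V a b (-(ε a * ε b)) ≠ 0
  · obtain ⟨a, ha, b, hb, hab, hne⟩ := hun
    exact .inr ⟨fun x hx y hy z hz hxy hxz hyz σ τ =>
      hV.planeDet_ne_zero_of_unbalanced hT ha hb hab hne hx hy hz hxy hxz hyz σ τ, hsupp⟩
  · push Not at hun
    refine .inl ⟨ε, hT, fun a b hab u hu => ?_⟩
    obtain ⟨ha, hb⟩ := hsupp a b hab u hu
    refine ⟨ha, hb, ?_⟩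
    by_contra hne
    rw [Int.units_ne_iff_eq_neg.1 hne] at hu
    exact hu (hun a ha b hb hab)

end IsResonantLabelling

end Labelling

/-! ### Partition spaces of complete signed graphs -/

namespace TypeD

variable {n : ℕ}

theorem isOrthogonal_hyp {p q r l : Fin n} (hpq : p ≠ q) (hrl : r ≠ l) (σ τ : ℤˣ)
    (h : (p = r ∧ q = l ∨ p = l ∧ q = r) ∨ (p ≠ r ∧ p ≠ l ∧ q ≠ r ∧ q ≠ l)) :
    IsOrthogonal (hyp p q hpq σ) (hyp r l hrl τ) := by
  rcases h with (⟨rfl, rfl⟩ | ⟨rfl, rfl⟩) | ⟨h1, h2, h3, h4⟩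
  · exact .inl ⟨p, q, hpq, σ, τ, rfl, rfl⟩
  · exact .inl ⟨p, q, hpq, σ, τ, rfl, hyp_comm _ _⟩
  · exact .inr ⟨p, q, r, l, hpq, hrl, σ, τ, h1, h2, h3, h4, rfl, rfl⟩

theorem IsTriangle.isOrthogonal_left_or {g h k : Hyp n} (H : IsTriangle g h k) (m : Hyp n) :
    IsOrthogonal m g ∨ IsOrthogonal m h ∨ IsOrthogonal m k := by
  obtain ⟨p, q, r, hpq, hpr, hqr, σ, τ, rfl, rfl, rfl⟩ := H
  obtain ⟨a, b, hab, ρ, rfl⟩ := exists_eq_hyp m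
  have hab' := hab.ne
  by_contra! hcon
  obtain ⟨h1, h2, h3⟩ := hcon
  have h1 := mt (isOrthogonal_hyp hab' hpq ρ σ) h1
  have h2 := mt (isOrthogonal_hyp hab' hpr ρ τ) h2
  have h3 := mt (isOrthogonal_hyp hab' hqr ρ (σ * τ)) h3
  grind

theorem ker_form_ne {g h : Hyp n} (hgh : g ≠ h) :
    LinearMap.ker (form g) ≠ LinearMap.ker (form h) := by
  obtain ⟨x, hx, hx'⟩ := exists_form_eq_zero_ne_zero hgh
  intro heq
  have : x ∈ LinearMap.ker (form h) := heq ▸ LinearMap.mem_ker.2 hx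
  exact hx' this

/-- `B` is the set of hyperplanes of a complete signed graph on the vertex set `T`, closed under
completing triangles, with a colouring in which exactly the orthogonal pairs have equal colours. -/
structure IsNet {κ : Type*} (T : Finset (Fin n)) (B : Set (Hyp n)) (c : Hyp n → κ) : Prop where
  mem : ∀ p q (h : p ≠ q) τ, hyp p q h τ ∈ B → p ∈ T ∧ q ∈ T
  full : ∀ p ∈ T, ∀ q ∈ T, ∀ h : p ≠ q, ∃ τ, hyp p q h τ ∈ B
  closed : ∀ g h k, IsTriangle g h k → g ∈ B → h ∈ B → k ∈ B
  colour_ne : ∀ g h k, IsTriangle g h k → g ∈ B → h ∈ B → c g ≠ c h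
  colour_eq : ∀ g h, IsOrthogonal g h → g ∈ B → h ∈ B → c g = c h
  card : T.card = 3 ∨ T.card = 4

theorem exists_sorted_triple {T : Finset (Fin n)} (h : T.card = 3) :
    ∃ i j k, i < j ∧ j < k ∧ T = {i, j, k} := by
  refine ⟨T.orderEmbOfFin h 0, T.orderEmbOfFin h 1, T.orderEmbOfFin h 2, ?_, ?_, ?_⟩
  · exact (T.orderEmbOfFin h).strictMono (by decide)
  · exact (T.orderEmbOfFin h).strictMono (by decide)
  · ext x
    rw [← Finset.mem_coe, ← T.range_orderEmbOfFin h, Set.mem_range]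
    simp [Fin.exists_fin_succ, eq_comm]

theorem exists_sorted_quadruple {T : Finset (Fin n)} (h : T.card = 4) :
    ∃ i j k l, i < j ∧ j < k ∧ k < l ∧ T = {i, j, k, l} := by
  refine ⟨T.orderEmbOfFin h 0, T.orderEmbOfFin h 1, T.orderEmbOfFin h 2, T.orderEmbOfFin h 3,
    ?_, ?_, ?_, ?_⟩
  · exact (T.orderEmbOfFin h).strictMono (by decide)
  · exact (T.orderEmbOfFin h).strictMono (by decide)
  · exact (T.orderEmbOfFin h).strictMono (by decide)
  · ext x
    rw [← Finset.mem_coe, ← T.range_orderEmbOfFin h, Set.mem_range]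
    simp [Fin.exists_fin_succ, eq_comm]

section Sum

variable {K : Type*} [Field K]

/-- The sum of the coordinates over the two hyperplanes on a pair of indices `p < q`. -/
noncomputable def pairSum (u : Hyp n → K) (p q : Fin n) : K :=
  if h : p < q then u (hyp p q h.ne 1) + u (hyp p q h.ne (-1)) else 0

theorem pairSum_eq (u : Hyp n → K) {p q : Fin n} (h : p < q) (σ : ℤˣ) :
    pairSum u p q = u (hyp p q h.ne σ) + u (hyp p q h.ne (-σ)) := by
  rw [pairSum, dif_pos h]
  rcases Int.units_eq_one_or σ with rfl | rfl
  · rfl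
  · rw [neg_neg, add_comm]

theorem sum_eq_sum_pairSum (u : Hyp n → K) : ∑ g, u g = ∑ p, ∑ q, pairSum u p q := by
  classical
  have h1 : ∑ g, u g = ∑ x : Fin n × Fin n × ℤˣ, if h : x.1 < x.2.1 then u ⟨x, h⟩ else 0 := by
    rw [← Finset.sum_filter_add_sum_filter_not Finset.univ
        (fun x : Fin n × Fin n × ℤˣ => x.1 < x.2.1),
      Finset.sum_eq_zero (s := Finset.filter (fun x : Fin n × Fin n × ℤˣ => ¬ x.1 < x.2.1) _),
      add_zero]
    · rw [Finset.sum_subtype (p := fun x : Fin n × Fin n × ℤˣ => x.1 < x.2.1) _ (by simp)]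
      refine Finset.sum_congr rfl fun g _ => ?_
      rw [dif_pos g.2]
    · intro x hx
      rw [dif_neg (Finset.mem_filter.1 hx).2]
  rw [h1, Fintype.sum_prod_type]
  refine Finset.sum_congr rfl fun p _ => ?_
  rw [Fintype.sum_prod_type]
  refine Finset.sum_congr rfl fun q _ => ?_
  have huniv : (Finset.univ : Finset ℤˣ) = {1, -1} := rfl
  rw [huniv, Finset.sum_pair (by decide), pairSum]
  split_ifs with h
  · rw [hyp_of_lt, hyp_of_lt, neg_neg, add_comm]
  · rw [add_zero]

theorem sum_eq_sum_pairSum_of_support (u : Hyp n → K) (T : Finset (Fin n))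
    (hu : ∀ p q (h : p ≠ q) τ, u (hyp p q h τ) ≠ 0 → p ∈ T ∧ q ∈ T) :
    ∑ g, u g = ∑ p ∈ T, ∑ q ∈ T, pairSum u p q := by
  have hzero : ∀ p q, ¬ (p ∈ T ∧ q ∈ T) → pairSum u p q = 0 := by
    intro p q hpq
    rw [pairSum]
    split_ifs with h
    · rw [not_not.1 (mt (hu p q h.ne 1) hpq), not_not.1 (mt (hu p q h.ne (-1)) hpq), add_zero]
    · rfl
  rw [sum_eq_sum_pairSum]
  refine (Finset.sum_subset (Finset.subset_univ T) fun p _ hp => ?_).symm.trans ?_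
  · exact Finset.sum_eq_zero fun q _ => hzero p q fun h => hp h.1
  · refine Finset.sum_congr rfl fun p _ => ?_
    exact (Finset.sum_subset (Finset.subset_univ T) fun q _ hq => hzero p q fun h => hq h.2).symm

end Sum

/-- The vector `u` is supported on `B`, and its coordinate sums over the triangles in `B` vanish. -/
def TriangleSumZero {K : Type*} [Field K] (B : Set (Hyp n)) (u : Hyp n → K) : Prop :=
  (∀ g, g ∉ B → u g = 0) ∧ ∀ g h k, IsTriangle g h k → g ∈ B → h ∈ B → k ∈ B → u g + u h + u k = 0

namespace IsNet

variable {κ : Type*} {T : Finset (Fin n)} {B : Set (Hyp n)} {c : Hyp n → κ} {K : Type*} [Field K]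

theorem exists_third (hB : IsNet T B c) (p q : Fin n) : ∃ r ∈ T, p ≠ r ∧ q ≠ r := by
  have h1 : ((T.erase p).erase q).Nonempty := by
    rw [← Finset.card_pos]
    have h1 := Finset.pred_card_le_card_erase (s := T) (a := p)
    have h2 := Finset.pred_card_le_card_erase (s := T.erase p) (a := q)
    have := hB.card
    omega
  obtain ⟨r, hr⟩ := h1
  simp only [Finset.mem_erase] at hr
  exact ⟨r, hr.2.2, hr.2.1.symm, hr.1.symm⟩

theorem mem_third (hB : IsNet T B c) {p q r : Fin n} (hpq : p ≠ q) (hpr : p ≠ r) (hqr : q ≠ r)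
    {σ τ : ℤˣ} (h1 : hyp p q hpq σ ∈ B) (h2 : hyp p r hpr τ ∈ B) : hyp q r hqr (σ * τ) ∈ B :=
  hB.closed _ _ _ ⟨p, q, r, hpq, hpr, hqr, σ, τ, rfl, rfl, rfl⟩ h1 h2

/-- If a net contains both hyperplanes on the pair `{p, q}`, it contains those on `{q, r}` and on
`{p, r}`. -/
theorem mem_of_opposite (hB : IsNet T B c) {p q r : Fin n} (hpq : p ≠ q) (hpr : p ≠ r)
    (hqr : q ≠ r) {σ τ : ℤˣ} (h1 : hyp p q hpq σ ∈ B) (h2 : hyp p q hpq (-σ) ∈ B)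
    (h3 : hyp p r hpr τ ∈ B) :
    hyp q r hqr (σ * τ) ∈ B ∧ hyp q r hqr (-(σ * τ)) ∈ B ∧ hyp p r hpr (-τ) ∈ B := by
  have h4 := hB.mem_third hpq hpr hqr h1 h3
  have h5 := hB.mem_third hpq hpr hqr h2 h3
  rw [neg_mul] at h5
  refine ⟨h4, h5, ?_⟩
  rw [hyp_comm] at h1
  have := hB.mem_third hpq.symm hqr hpr h1 h5
  rwa [mul_neg, ← mul_assoc, Int.units_mul_self, one_mul] at this

theorem exists_isTriangle (hB : IsNet T B c) :
    ∃ g h k, IsTriangle g h k ∧ g ∈ B ∧ h ∈ B ∧ k ∈ B := by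
  have h1 : T.Nonempty := by
    rw [← Finset.card_pos]
    have := hB.card
    omega
  obtain ⟨p, hp⟩ := h1
  obtain ⟨q, hq, hpq, -⟩ := hB.exists_third p p
  obtain ⟨r, hr, hpr, hqr⟩ := hB.exists_third p q
  obtain ⟨σ, hσ⟩ := hB.full p hp q hq hpq
  obtain ⟨τ, hτ⟩ := hB.full p hp r hr hpr
  exact ⟨_, _, _, ⟨p, q, r, hpq, hpr, hqr, σ, τ, rfl, rfl, rfl⟩, hσ, hτ,
    hB.mem_third hpq hpr hqr hσ hτ⟩

theorem sum_triangle (hB : IsNet T B c) {u : Hyp n → K} (hu : TriangleSumZero B u)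
    {p q r : Fin n} (hpq : p ≠ q) (hpr : p ≠ r) (hqr : q ≠ r) {σ τ : ℤˣ}
    (h1 : hyp p q hpq σ ∈ B) (h2 : hyp p r hpr τ ∈ B) :
    u (hyp p q hpq σ) + u (hyp p r hpr τ) + u (hyp q r hqr (σ * τ)) = 0 :=
  hu.2 _ _ _ ⟨p, q, r, hpq, hpr, hqr, σ, τ, rfl, rfl, rfl⟩ h1 h2 (hB.mem_third hpq hpr hqr h1 h2)

/-- If a net contains both hyperplanes on the pair `{p, q}`, then the four triangles on `p, q, r`
in it give four linear equations. -/
theorem sums_of_opposite (hB : IsNet T B c) {u : Hyp n → K} (hu : TriangleSumZero B u)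
    {p q r : Fin n} (hpq : p ≠ q) (hpr : p ≠ r) (hqr : q ≠ r) {σ τ : ℤˣ}
    (h1 : hyp p q hpq σ ∈ B) (h2 : hyp p q hpq (-σ) ∈ B) (h3 : hyp p r hpr τ ∈ B) :
    u (hyp p q hpq σ) + u (hyp p r hpr τ) + u (hyp q r hqr (σ * τ)) = 0 ∧
    u (hyp p q hpq (-σ)) + u (hyp p r hpr τ) + u (hyp q r hqr (-(σ * τ))) = 0 ∧
    u (hyp p q hpq σ) + u (hyp p r hpr (-τ)) + u (hyp q r hqr (-(σ * τ))) = 0 ∧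
    u (hyp p q hpq (-σ)) + u (hyp p r hpr (-τ)) + u (hyp q r hqr (σ * τ)) = 0 := by
  obtain ⟨-, -, h4⟩ := hB.mem_of_opposite hpq hpr hqr h1 h2 h3
  have e1 := hB.sum_triangle hu hpq hpr hqr h1 h3
  have e2 := hB.sum_triangle hu hpq hpr hqr h2 h3
  have e3 := hB.sum_triangle hu hpq hpr hqr h1 h4
  have e4 := hB.sum_triangle hu hpq hpr hqr h2 h4
  rw [neg_mul] at e2
  rw [mul_neg] at e3
  rw [neg_mul_neg] at e4
  exact ⟨e1, e2, e3, e4⟩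

/-- The triangle equations force the coordinates at two orthogonal hyperplanes of a net to agree:
four triangle equations combine to twice the difference of the coordinates. -/
theorem eq_of_isOrthogonal (h2 : (2 : K) ≠ 0) (hB : IsNet T B c) {u : Hyp n → K}
    (hu : TriangleSumZero B u) {g h : Hyp n} (hgh : IsOrthogonal g h) (hg : g ∈ B) (hh : h ∈ B) :
    u g = u h := by
  rcases hgh with ⟨p, q, hpq, σ, τ, rfl, rfl⟩ | ⟨p, q, r, l, hpq, hrl, σ, τ, hpr, hpl, hqr, hql,
    rfl, rfl⟩
  · by_cases hστ : τ = σ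
    · rw [hστ]
    rw [Int.units_ne_iff_eq_neg.1 hστ] at hh ⊢
    obtain ⟨hp, hq⟩ := hB.mem _ _ _ _ hg
    obtain ⟨r, hr, hpr, hqr⟩ := hB.exists_third p q
    obtain ⟨t, ht⟩ := hB.full p hp r hr hpr
    obtain ⟨e1, e2, e3, e4⟩ := hB.sums_of_opposite hu hpq hpr hqr hg hh ht
    refine mul_left_cancel₀ h2 ?_
    linear_combination e1 - e2 + e3 - e4
  · obtain ⟨hp, hq⟩ := hB.mem _ _ _ _ hg
    obtain ⟨hr, hl⟩ := hB.mem _ _ _ _ hh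
    obtain ⟨t, ht⟩ := hB.full p hp r hr hpr
    have e1 := hB.sum_triangle hu hpq hpr hqr hg ht
    have m1 := hB.mem_third hpq hpr hqr hg ht
    have ht' := ht
    rw [hyp_comm] at ht'
    have e2 := hB.sum_triangle hu hpr.symm hrl hpl ht' hh
    have m2 := hB.mem_third hpr.symm hrl hpl ht' hh
    have e3 := hB.sum_triangle hu hpq hpl hql hg m2
    rw [hyp_comm] at m1
    have e4 := hB.sum_triangle hu hqr.symm hrl hql m1 hh
    rw [hyp_comm] at e2 e4
    rw [mul_assoc] at e4
    refine mul_left_cancel₀ h2 ?_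
    linear_combination e1 - e2 + e3 - e4

theorem pairSum_add_eq_zero (h2 : (2 : K) ≠ 0) (hB : IsNet T B c) {u : Hyp n → K}
    (hu : TriangleSumZero B u) {p q r : Fin n} (hp : p ∈ T) (hq : q ∈ T) (hr : r ∈ T)
    (hpq : p < q) (hqr : q < r) : pairSum u p q + pairSum u p r + pairSum u q r = 0 := by
  have hpr := hpq.trans hqr
  obtain ⟨σ, hσ⟩ := hB.full p hp q hq hpq.ne
  obtain ⟨τ, hτ⟩ := hB.full p hp r hr hpr.ne
  rw [pairSum_eq u hpq σ, pairSum_eq u hpr τ, pairSum_eq u hqr (σ * τ)]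
  by_cases hneg : hyp p q hpq.ne (-σ) ∈ B
  · obtain ⟨e1, e2, e3, e4⟩ := hB.sums_of_opposite hu hpq.ne hpr.ne hqr.ne hσ hneg hτ
    refine mul_left_cancel₀ h2 ?_
    linear_combination e1 + e2 + e3 + e4
  -- otherwise only one hyperplane on each of the three pairs of indices belongs to the net
  · have m := hB.mem_third hpq.ne hpr.ne hqr.ne hσ hτ
    have hneg2 : hyp p r hpr.ne (-τ) ∉ B := by
      intro h
      rw [hyp_comm] at h m
      have := hB.mem_third hpr.ne' hqr.ne' hpq.ne h m
      rw [mul_left_comm, neg_mul, Int.units_mul_self, mul_neg, mul_one] at this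
      exact hneg this
    have hneg3 : hyp q r hqr.ne (-(σ * τ)) ∉ B := by
      intro h
      rw [hyp_comm] at h hτ
      have := hB.mem_third hpr.ne' hqr.ne' hpq.ne hτ h
      rw [mul_neg, mul_left_comm, Int.units_mul_self, mul_one] at this
      exact hneg this
    rw [hu.1 _ hneg, hu.1 _ hneg2, hu.1 _ hneg3]
    linear_combination hB.sum_triangle hu hpq.ne hpr.ne hqr.ne hσ hτ

theorem sum_eq_zero (h2 : (2 : K) ≠ 0) (hB : IsNet T B c) {u : Hyp n → K}
    (hu : TriangleSumZero B u) : ∑ g, u g = 0 := by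
  classical
  have hzero : ∀ a b : Fin n, b ≤ a → pairSum u a b = 0 := fun a b hab => by
    rw [pairSum, dif_neg hab.not_gt]
  rw [sum_eq_sum_pairSum_of_support u T fun p q h τ hne =>
    hB.mem p q h τ (by_contra fun hn => hne (hu.1 _ hn))]
  rcases hB.card with hc | hc
  · obtain ⟨i, j, k, hij, hjk, rfl⟩ := exists_sorted_triple hc
    have hik := hij.trans hjk
    have e := hB.pairSum_add_eq_zero h2 hu (by simp) (by simp) (by simp) hij hjk
    have hi : i ∉ ({j, k} : Finset (Fin n)) := by simp [hij.ne, hik.ne]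
    simp only [Finset.sum_insert hi, Finset.sum_pair hjk.ne]
    rw [hzero i i le_rfl, hzero j j le_rfl, hzero k k le_rfl, hzero j i hij.le, hzero k i hik.le,
      hzero k j hjk.le]
    linear_combination e
  · obtain ⟨i, j, k, l, hij, hjk, hkl, rfl⟩ := exists_sorted_quadruple hc
    have hik := hij.trans hjk
    have hjl := hjk.trans hkl
    have hil := hij.trans hjl
    have e1 := hB.pairSum_add_eq_zero h2 hu (by simp) (by simp) (by simp) hij hjk
    have e2 := hB.pairSum_add_eq_zero h2 hu (by simp) (by simp) (by simp) hij hjl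
    have e3 := hB.pairSum_add_eq_zero h2 hu (by simp) (by simp) (by simp) hik hkl
    have e4 := hB.pairSum_add_eq_zero h2 hu (by simp) (by simp) (by simp) hjk hkl
    have hi : i ∉ ({j, k, l} : Finset (Fin n)) := by simp [hij.ne, hik.ne, hil.ne]
    have hj : j ∉ ({k, l} : Finset (Fin n)) := by simp [hjk.ne, hjl.ne]
    simp only [Finset.sum_insert hi, Finset.sum_insert hj, Finset.sum_pair hkl.ne]
    rw [hzero i i le_rfl, hzero j j le_rfl, hzero k k le_rfl, hzero l l le_rfl, hzero j i hij.le,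
      hzero k i hik.le, hzero k j hjk.le, hzero l i hil.le, hzero l j hjl.le, hzero l k hkl.le]
    refine mul_left_cancel₀ h2 ?_
    linear_combination e1 + e2 + e3 + e4

/-- The equations of the partition space of a net are those of the triangles in the net. -/
theorem mem_partitionSpace_iff (h2 : (2 : K) ≠ 0) (hB : IsNet T B c) (u : Hyp n → K) :
    u ∈ partitionSpace K form B c ↔ TriangleSumZero B u := by
  constructor
  · rintro ⟨-, h3, h4⟩
    refine ⟨h4, fun g h k H hg hh _ => ?_⟩
    have := h3 _ ⟨g, hg, h, hh, ker_form_ne H.ne, rfl⟩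
      ⟨g, hg, h, hh, inf_le_left, inf_le_right, hB.colour_ne g h k H hg hh⟩
    rwa [← flatSum_apply, H.flatSum_eq] at this
  · intro hu
    refine ⟨hB.sum_eq_zero h2 hu, ?_, hu.1⟩
    rintro _ ⟨g, hg, h, hh, hgh, rfl⟩ ⟨a, ha, b, hb, hla, hlb, hab⟩
    have hne : g ≠ h := fun h => hgh (by rw [h])
    rw [← flatSum_apply]
    rcases isOrthogonal_or_exists_isTriangle g h with hort | ⟨k, hk⟩
    · -- the hyperplanes through a flat which is not on a triangle all have the same colour
      have hc := hB.colour_eq g h hort hg hh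
      exfalso
      apply hab
      rcases (hort.le_ker_iff hne a).1 hla with rfl | rfl <;>
        rcases (hort.le_ker_iff hne b).1 hlb with rfl | rfl <;> simp [hc]
    · rw [hk.flatSum_eq]
      exact hu.2 g h k hk hg hh (hB.closed g h k hk hg hh)

theorem colour_mem_triangle (hB : IsNet T B c) {g h k m : Hyp n} (H : IsTriangle g h k)
    (hg : g ∈ B) (hh : h ∈ B) (hk : k ∈ B) (hm : m ∈ B) : c m = c g ∨ c m = c h ∨ c m = c k := by
  rcases H.isOrthogonal_left_or m with h' | h' | h'
  · exact .inl (hB.colour_eq _ _ h' hm hg)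
  · exact .inr (.inl (hB.colour_eq _ _ h' hm hh))
  · exact .inr (.inr (hB.colour_eq _ _ h' hm hk))

theorem eq_of_colour_eq (h2 : (2 : K) ≠ 0) (hB : IsNet T B c) {u : Hyp n → K}
    (hu : TriangleSumZero B u) {g h : Hyp n} (hg : g ∈ B) (hh : h ∈ B) (hgh : c g = c h) :
    u g = u h := by
  rcases isOrthogonal_or_exists_isTriangle g h with hort | ⟨k, hk⟩
  · exact hB.eq_of_isOrthogonal h2 hu hort hg hh
  · exact absurd hgh (hB.colour_ne g h k hk hg hh)

open Classical in
/-- The coordinates of a vector in the partition space of a net may be prescribed on two of the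
three hyperplanes of a triangle. -/
theorem exists_triangleSumZero (hB : IsNet T B c) {g h k : Hyp n} (H : IsTriangle g h k)
    (hg : g ∈ B) (hh : h ∈ B) (x y : K) :
    ∃ u : Hyp n → K, TriangleSumZero B u ∧ u g = x ∧ u h = y := by
  have hk := hB.closed g h k H hg hh
  have c1 := hB.colour_ne g h k H hg hh
  have c2 := hB.colour_ne h k g H.rotate hh hk
  have c3 := hB.colour_ne k g h H.rotate.rotate hk hg
  refine ⟨fun m => if m ∈ B then if c m = c g then x else if c m = c h then y else -(x + y) else 0,
    ⟨fun m hm => if_neg hm, fun a b d H' ha hb hd => ?_⟩, by simp [hg], by simp [hh, c1.symm]⟩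
  have d1 := hB.colour_ne a b d H' ha hb
  have d2 := hB.colour_ne b d a H'.rotate hb hd
  have d3 := hB.colour_ne d a b H'.rotate.rotate hd ha
  simp only [if_pos ha, if_pos hb, if_pos hd]
  rcases hB.colour_mem_triangle H hg hh hk ha with ea | ea | ea <;>
    rcases hB.colour_mem_triangle H hg hh hk hb with eb | eb | eb <;>
    rcases hB.colour_mem_triangle H hg hh hk hd with ed | ed | ed <;>
    rw [ea, eb] at d1 <;> rw [eb, ed] at d2 <;> rw [ed, ea] at d3 <;>
    first
    | exact absurd rfl d1
    | exact absurd rfl d2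
    | exact absurd rfl d3
    | (simp only [ea, eb, ed, if_true, if_neg c1.symm, if_neg c2.symm, if_neg c3]
       ring)

theorem finrank_partitionSpace (h2 : (2 : K) ≠ 0) (hB : IsNet T B c) :
    Module.finrank K (partitionSpace K form B c) = 2 := by
  obtain ⟨g, h, k, H, hg, hh, hk⟩ := hB.exists_isTriangle
  let φ : partitionSpace K form B c →ₗ[K] K × K :=
    ((LinearMap.proj g).prod (LinearMap.proj h)).comp (Submodule.subtype _)
  have hφ : ∀ u, φ u = (u.1 g, u.1 h) := fun u => rfl
  have hinj : Function.Injective φ := by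
    rw [injective_iff_map_eq_zero]
    rintro ⟨u, hu⟩ h0
    rw [hφ, Prod.mk_eq_zero] at h0
    obtain ⟨hug, huh⟩ := h0
    rw [hB.mem_partitionSpace_iff h2] at hu
    have huk := hu.2 g h k H hg hh hk
    simp only at hug huh
    rw [hug, huh, add_zero, zero_add] at huk
    ext m
    by_cases hm : m ∈ B
    · rcases hB.colour_mem_triangle H hg hh hk hm with e | e | e
      · exact (hB.eq_of_colour_eq h2 hu hm hg e).trans hug
      · exact (hB.eq_of_colour_eq h2 hu hm hh e).trans huh
      · exact (hB.eq_of_colour_eq h2 hu hm hk e).trans huk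
    · exact hu.1 m hm
  have hsurj : Function.Surjective φ := by
    rintro ⟨x, y⟩
    obtain ⟨u, hu, hx, hy⟩ := hB.exists_triangleSumZero H hg hh x y
    exact ⟨⟨u, (hB.mem_partitionSpace_iff h2 u).2 hu⟩, by rw [hφ]; exact Prod.ext hx hy⟩
  rw [(LinearEquiv.ofBijective φ ⟨hinj, hsurj⟩).finrank_eq]
  simp

theorem mem_iff_exists_ne_zero (h2 : (2 : K) ≠ 0) (hB : IsNet T B c) (g : Hyp n) :
    g ∈ B ↔ ∃ u ∈ partitionSpace K form B c, u g ≠ 0 := by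
  constructor
  · intro hg
    obtain ⟨p, q, hpq, σ, rfl⟩ := exists_eq_hyp g
    obtain ⟨hp, -⟩ := hB.mem _ _ _ _ hg
    obtain ⟨r, hr, hpr, hqr⟩ := hB.exists_third p q
    obtain ⟨τ, hτ⟩ := hB.full p hp r hr hpr
    obtain ⟨u, hu, hx, -⟩ := hB.exists_triangleSumZero
      ⟨p, q, r, hpq.ne, hpr, hqr, σ, τ, rfl, rfl, rfl⟩ hg hτ (1 : K) 0
    exact ⟨u, (hB.mem_partitionSpace_iff h2 u).2 hu, by rw [hx]; exact one_ne_zero⟩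
  · rintro ⟨u, hu, hne⟩
    by_contra hg
    exact hne (((hB.mem_partitionSpace_iff h2 u).1 hu).1 g hg)

/-- Any two elements of the partition space of a net satisfy the local resonance conditions. -/
theorem partitionSpace_subset_resonanceVariety (h2 : (2 : K) ≠ 0) (hB : IsNet T B c) :
    (partitionSpace K form B c : Set (Hyp n → K)) ⊆ resonanceVariety K form := by
  intro u hu
  obtain ⟨w, hw, hwu⟩ : ∃ w ∈ partitionSpace K form B c, ∀ a : K, w ≠ a • u := by
    by_contra! hcon
    have hle : partitionSpace K form B c ≤ K ∙ u := by
      intro w hw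
      obtain ⟨a, ha⟩ := hcon w hw
      exact Submodule.mem_span_singleton.2 ⟨a, ha.symm⟩
    have h1 := Submodule.finrank_mono hle
    rw [hB.finrank_partitionSpace h2] at h1
    have h3 := finrank_span_le_card (R := K) ({u} : Set (Hyp n → K))
    simp at h3
    omega
  rw [mem_resonanceVariety_form_iff]
  have hu := (hB.mem_partitionSpace_iff h2 u).1 hu
  have hw := (hB.mem_partitionSpace_iff h2 w).1 hw
  refine ⟨w, hwu, fun g h hgh => ?_, fun g h k H => ?_⟩
  · by_cases hg : g ∈ B
    · by_cases hh : h ∈ B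
      · rw [hB.eq_of_isOrthogonal h2 hu hgh hg hh, hB.eq_of_isOrthogonal h2 hw hgh hg hh, mul_comm]
      · rw [hu.1 h hh, hw.1 h hh, mul_zero, mul_zero]
    · rw [hu.1 g hg, hw.1 g hg, zero_mul, zero_mul]
  · by_cases hg : g ∈ B
    · by_cases hh : h ∈ B
      · have hk := hB.closed g h k H hg hh
        rw [hu.2 g h k H hg hh hk, hw.2 g h k H hg hh hk, mul_zero, mul_zero]
      · have hk : k ∉ B := fun hk => hh (hB.closed k g h H.rotate.rotate hk hg)
        rw [hu.1 h hh, hw.1 h hh, hu.1 k hk, hw.1 k hk]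
        ring
    · rw [hu.1 g hg, hw.1 g hg, zero_mul, zero_mul]

end IsNet

end TypeD

/-! ### The complete and the balanced subarrangements -/

namespace TypeD

variable {n : ℕ}

/-- The hyperplanes with both indices in `T`. -/
def fullHyps (T : Finset (Fin n)) : Set (Hyp n) :=
  {g | g.1.1 ∈ T ∧ g.1.2.1 ∈ T}

/-- The hyperplanes `x_p = ε_p ε_q x_q` with both indices in `T`, i.e. the braid arrangement on the
indices in `T` in the coordinates `ε_p x_p`. -/
def balancedHyps (T : Finset (Fin n)) (ε : Fin n → ℤˣ) : Set (Hyp n) :=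
  {g | g.1.1 ∈ T ∧ g.1.2.1 ∈ T ∧ g.1.2.2 = -(ε g.1.1 * ε g.1.2.1)}

theorem hyp_mem_fullHyps {T : Finset (Fin n)} {p q : Fin n} (h : p ≠ q) (τ : ℤˣ) :
    hyp p q h τ ∈ fullHyps T ↔ p ∈ T ∧ q ∈ T := by
  unfold hyp fullHyps
  split_ifs
  · exact Iff.rfl
  · exact and_comm

theorem hyp_mem_balancedHyps {T : Finset (Fin n)} {ε : Fin n → ℤˣ} {p q : Fin n} (h : p ≠ q)
    (τ : ℤˣ) : hyp p q h τ ∈ balancedHyps T ε ↔ p ∈ T ∧ q ∈ T ∧ τ = ε p * ε q := by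
  unfold hyp balancedHyps
  split_ifs
  · simp
  · simp only [Set.mem_ofPred_eq, neg_inj, mul_comm (ε q)]
    tauto

/-- A colouring of the hyperplanes with indices in `T` in which the colours of two hyperplanes agree
if and only if their pairs of indices are equal or disjoint. -/
structure IsEdgeColouring {κ : Type*} (T : Finset (Fin n)) (c : Hyp n → κ) : Prop where
  adjacent : ∀ p ∈ T, ∀ q ∈ T, ∀ r ∈ T, ∀ (hpq : p ≠ q) (hpr : p ≠ r), q ≠ r → ∀ σ τ,
    c (hyp p q hpq σ) ≠ c (hyp p r hpr τ)
  opposite : ∀ p ∈ T, ∀ q ∈ T, ∀ (hpq : p ≠ q) σ τ, c (hyp p q hpq σ) = c (hyp p q hpq τ)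
  disjoint : ∀ p ∈ T, ∀ q ∈ T, ∀ r ∈ T, ∀ l ∈ T, ∀ (hpq : p ≠ q) (hrl : r ≠ l), p ≠ r → p ≠ l →
    q ≠ r → q ≠ l → ∀ σ τ, c (hyp p q hpq σ) = c (hyp r l hrl τ)

namespace IsEdgeColouring

variable {κ : Type*} {T : Finset (Fin n)} {c : Hyp n → κ}

theorem isNet_fullHyps (hc : IsEdgeColouring T c) (hT : T.card = 3 ∨ T.card = 4) :
    IsNet T (fullHyps T) c where
  mem p q h τ := (hyp_mem_fullHyps h τ).1
  full p hp q hq h := ⟨1, (hyp_mem_fullHyps h 1).2 ⟨hp, hq⟩⟩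
  closed := by
    rintro _ _ _ ⟨p, q, r, hpq, hpr, hqr, σ, τ, rfl, rfl, rfl⟩ hg hh
    rw [hyp_mem_fullHyps] at *
    exact ⟨hg.2, hh.2⟩
  colour_ne := by
    rintro _ _ _ ⟨p, q, r, hpq, hpr, hqr, σ, τ, rfl, rfl, rfl⟩ hg hh
    rw [hyp_mem_fullHyps] at hg hh
    exact hc.adjacent p hg.1 q hg.2 r hh.2 hpq hpr hqr σ τ
  colour_eq := by
    rintro g h hgh hg hh
    rcases hgh with ⟨p, q, hpq, σ, τ, rfl, rfl⟩ | ⟨p, q, r, l, hpq, hrl, σ, τ, hpr, hpl, hqr, hql,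
      rfl, rfl⟩ <;> rw [hyp_mem_fullHyps] at hg hh
    · exact hc.opposite p hg.1 q hg.2 hpq σ τ
    · exact hc.disjoint p hg.1 q hg.2 r hh.1 l hh.2 hpq hrl hpr hpl hqr hql σ τ
  card := hT

theorem isNet_balancedHyps (hc : IsEdgeColouring T c) (hT : T.card = 3 ∨ T.card = 4)
    (ε : Fin n → ℤˣ) : IsNet T (balancedHyps T ε) c where
  mem p q h τ H := ⟨((hyp_mem_balancedHyps h τ).1 H).1, ((hyp_mem_balancedHyps h τ).1 H).2.1⟩
  full p hp q hq h := ⟨ε p * ε q, (hyp_mem_balancedHyps h _).2 ⟨hp, hq, rfl⟩⟩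
  closed := by
    rintro _ _ _ ⟨p, q, r, hpq, hpr, hqr, σ, τ, rfl, rfl, rfl⟩ hg hh
    rw [hyp_mem_balancedHyps] at *
    refine ⟨hg.2.1, hh.2.1, ?_⟩
    rw [hg.2.2, hh.2.2, mul_mul_mul_comm, Int.units_mul_self, one_mul]
  colour_ne := by
    rintro _ _ _ ⟨p, q, r, hpq, hpr, hqr, σ, τ, rfl, rfl, rfl⟩ hg hh
    rw [hyp_mem_balancedHyps] at hg hh
    exact hc.adjacent p hg.1 q hg.2.1 r hh.2.1 hpq hpr hqr σ τ
  colour_eq := by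
    rintro g h hgh hg hh
    rcases hgh with ⟨p, q, hpq, σ, τ, rfl, rfl⟩ | ⟨p, q, r, l, hpq, hrl, σ, τ, hpr, hpl, hqr, hql,
      rfl, rfl⟩ <;> rw [hyp_mem_balancedHyps] at hg hh
    · exact hc.opposite p hg.1 q hg.2.1 hpq σ τ
    · exact hc.disjoint p hg.1 q hg.2.1 r hh.1 l hh.2.1 hpq hrl hpr hpl hqr hql σ τ
  card := hT

end IsEdgeColouring

theorem pairColour_hyp {p q : Fin n} (h : p ≠ q) (τ : ℤˣ) :
    pairColour (hyp p q h τ) = if p < q then (p, q) else (q, p) := by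
  unfold hyp pairColour
  split_ifs <;> rfl

theorem isEdgeColouring_pairColour {T : Finset (Fin n)} (hT : T.card = 3) :
    IsEdgeColouring T pairColour where
  adjacent p hp q hq r hr hpq hpr hqr σ τ := by
    rw [pairColour_hyp, pairColour_hyp]
    split_ifs <;> grind
  opposite p hp q hq hpq σ τ := by rw [pairColour_hyp, pairColour_hyp]
  disjoint p hp q hq r hr l hl hpq hrl hpr hpl hqr hql σ τ := by
    -- four distinct indices do not fit into a set of size three
    have hle : ({p, q, r, l} : Finset (Fin n)) ⊆ T := by
      intro x hx
      simp only [Finset.mem_insert, Finset.mem_singleton] at hx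
      rcases hx with rfl | rfl | rfl | rfl <;> assumption
    have := Finset.card_le_card hle
    rw [Finset.card_insert_of_notMem (by simp [hpq, hpr, hpl]),
      Finset.card_insert_of_notMem (by simp [hqr, hql]), Finset.card_pair hrl] at this
    omega

theorem isEdgeColouring_matchingColour {i j k l : Fin n} (hij : i < j) (hjk : j < k) (hkl : k < l) :
    IsEdgeColouring {i, j, k, l} (matchingColour i j k l) := by
  have hik := hij.trans hjk
  have hjl := hjk.trans hkl
  have hil := hij.trans hjl
  have main : ∀ {p q : Fin n} (h : p < q) (h' : p ≠ q) (τ : ℤˣ),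
      matchingColour i j k l (hyp p q h' τ) =
        (if (p, q) = (i, j) ∨ (p, q) = (k, l) then 0
        else if (p, q) = (i, k) ∨ (p, q) = (j, l) then 1 else 2) ∧
      matchingColour i j k l (hyp q p h'.symm τ) =
        (if (p, q) = (i, j) ∨ (p, q) = (k, l) then 0
        else if (p, q) = (i, k) ∨ (p, q) = (j, l) then 1 else 2) := by
    intro p q h h' τ
    rw [hyp_comm h'.symm]
    unfold matchingColour
    rw [pairColour_hyp, if_pos h]
    exact ⟨rfl, rfl⟩
  have n1 := hij.ne
  have n2 := hjk.ne
  have n3 := hkl.ne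
  have n4 := hik.ne
  have n5 := hjl.ne
  have n6 := hil.ne
  have cij := main hij n1
  have cik := main hik n4
  have cil := main hil n6
  have cjk := main hjk n2
  have cjl := main hjl n5
  have ckl := main hkl n3
  simp only [Prod.mk.injEq, n1, n2, n3, n4, n5, n1.symm, n2.symm, n3.symm, n4.symm, n5.symm,
    and_self, and_true, and_false, or_false, or_true, if_true, if_false] at cij cik cil cjk cjl ckl
  constructor
  · intro p hp q hq r hr hpq hpr hqr σ τ
    simp only [Finset.mem_insert, Finset.mem_singleton] at hp hq hr
    rcases hp with rfl | rfl | rfl | rfl <;> rcases hq with rfl | rfl | rfl | rfl <;>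
      first
      | exact absurd rfl hpq
      | (rcases hr with rfl | rfl | rfl | rfl <;>
          first
          | exact absurd rfl hpr
          | exact absurd rfl hqr
          | (simp only [cij, cik, cil, cjk, cjl, ckl]; decide))
  · intro p hp q hq hpq σ τ
    unfold matchingColour
    rw [pairColour_hyp, pairColour_hyp]
  · intro p hp q hq r hr m hm hpq hrm hpr hpm hqr hqm σ τ
    simp only [Finset.mem_insert, Finset.mem_singleton] at hp hq hr hm
    rcases hp with rfl | rfl | rfl | rfl <;> rcases hq with rfl | rfl | rfl | rfl <;>
      first
      | exact absurd rfl hpq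
      | (rcases hr with rfl | rfl | rfl | rfl <;>
          first
          | exact absurd rfl hpr
          | exact absurd rfl hqr
          | (rcases hm with rfl | rfl | rfl | rfl <;>
              first
              | exact absurd rfl hrm
              | exact absurd rfl hpm
              | exact absurd rfl hqm
              | simp only [cij, cik, cil, cjk, cjl, ckl]))

theorem pairHyps_triple {i j k : Fin n} (hij : i < j) (hjk : j < k) :
    pairHyps {(i, j), (i, k), (j, k)} = fullHyps {i, j, k} := by
  ext ⟨⟨a, b, s⟩, hab⟩
  simp only [pairHyps, fullHyps, Set.mem_ofPred_eq, Set.mem_insert_iff, Set.mem_singleton_iff,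
    Prod.mk.injEq, Finset.mem_insert, Finset.mem_singleton]
  change a < b at hab
  grind

theorem pairHyps_quadruple {i j k l : Fin n} (hij : i < j) (hjk : j < k) (hkl : k < l) :
    pairHyps {(i, j), (i, k), (i, l), (j, k), (j, l), (k, l)} = fullHyps {i, j, k, l} := by
  ext ⟨⟨a, b, s⟩, hab⟩
  simp only [pairHyps, fullHyps, Set.mem_ofPred_eq, Set.mem_insert_iff, Set.mem_singleton_iff,
    Prod.mk.injEq, Finset.mem_insert, Finset.mem_singleton]
  change a < b at hab
  grind

theorem signedHyps_triple {i j k : Fin n} (hij : i < j) (hjk : j < k) (ε : Fin n → ℤˣ) :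
    signedHyps {(i, j, -(ε i * ε j)), (i, k, -(ε i * ε k)), (j, k, -(ε j * ε k))} =
      balancedHyps {i, j, k} ε := by
  ext ⟨⟨a, b, s⟩, hab⟩
  simp only [signedHyps, balancedHyps, Set.mem_ofPred_eq, Set.mem_insert_iff,
    Set.mem_singleton_iff, Prod.mk.injEq, Finset.mem_insert, Finset.mem_singleton]
  change a < b at hab
  grind

theorem signedHyps_quadruple {i j k l : Fin n} (hij : i < j) (hjk : j < k) (hkl : k < l)
    (ε : Fin n → ℤˣ) :
    signedHyps {(i, j, -(ε i * ε j)), (i, k, -(ε i * ε k)), (i, l, -(ε i * ε l)),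
      (j, k, -(ε j * ε k)), (j, l, -(ε j * ε l)), (k, l, -(ε k * ε l))} =
      balancedHyps {i, j, k, l} ε := by
  ext ⟨⟨a, b, s⟩, hab⟩
  simp only [signedHyps, balancedHyps, Set.mem_ofPred_eq, Set.mem_insert_iff,
    Set.mem_singleton_iff, Prod.mk.injEq, Finset.mem_insert, Finset.mem_singleton]
  change a < b at hab
  grind

/-- The four sign patterns on a triple are the switchings of the all-minus pattern. -/
theorem exists_tripleSigns_eq (a b c : ℤˣ) : ∃ q, tripleSigns q 0 = -(a * b) ∧
    tripleSigns q 1 = -(a * c) ∧ tripleSigns q 2 = -(b * c) := by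
  revert a b c
  decide

theorem tripleSigns_eq_switching (q : Fin 4) : ∃ a b c : ℤˣ, tripleSigns q 0 = -(a * b) ∧
    tripleSigns q 1 = -(a * c) ∧ tripleSigns q 2 = -(b * c) := by
  revert q
  decide

/-- The eight sign patterns on a quadruple are the switchings of the all-minus pattern. -/
theorem exists_quadSigns_eq (a b c d : ℤˣ) : ∃ q, quadSigns q 0 = -(a * b) ∧
    quadSigns q 1 = -(a * c) ∧ quadSigns q 2 = -(a * d) ∧ quadSigns q 3 = -(b * c) ∧
    quadSigns q 4 = -(b * d) ∧ quadSigns q 5 = -(c * d) := by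
  revert a b c d
  decide

theorem quadSigns_eq_switching (q : Fin 8) : ∃ a b c d : ℤˣ, quadSigns q 0 = -(a * b) ∧
    quadSigns q 1 = -(a * c) ∧ quadSigns q 2 = -(a * d) ∧ quadSigns q 3 = -(b * c) ∧
    quadSigns q 4 = -(b * d) ∧ quadSigns q 5 = -(c * d) := by
  revert q
  decide

variable (K : Type*) [Field K]

theorem V3_eq {i j k : Fin n} (hij : i < j) (hjk : j < k) :
    V3 K i j k = partitionSpace K form (fullHyps {i, j, k}) pairColour := by
  rw [V3, pairHyps_triple hij hjk]

theorem W_eq {i j k l : Fin n} (hij : i < j) (hjk : j < k) (hkl : k < l) :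
    W K i j k l = partitionSpace K form (fullHyps {i, j, k, l}) (matchingColour i j k l) := by
  rw [W, pairHyps_quadruple hij hjk hkl]

theorem U_eq_of_signs {i j k : Fin n} (hij : i < j) (hjk : j < k) {q : Fin 4} {ε : Fin n → ℤˣ}
    (h : tripleSigns q 0 = -(ε i * ε j) ∧ tripleSigns q 1 = -(ε i * ε k) ∧
      tripleSigns q 2 = -(ε j * ε k)) :
    U K q i j k = partitionSpace K form (balancedHyps {i, j, k} ε) pairColour := by
  rw [U, h.1, h.2.1, h.2.2, signedHyps_triple hij hjk]

theorem V4_eq_of_signs {i j k l : Fin n} (hij : i < j) (hjk : j < k) (hkl : k < l) {q : Fin 8}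
    {ε : Fin n → ℤˣ}
    (h : quadSigns q 0 = -(ε i * ε j) ∧ quadSigns q 1 = -(ε i * ε k) ∧
      quadSigns q 2 = -(ε i * ε l) ∧ quadSigns q 3 = -(ε j * ε k) ∧
      quadSigns q 4 = -(ε j * ε l) ∧ quadSigns q 5 = -(ε k * ε l)) :
    V4 K q i j k l =
      partitionSpace K form (balancedHyps {i, j, k, l} ε) (matchingColour i j k l) := by
  obtain ⟨h0, h1, h2, h3, h4, h5⟩ := h
  rw [V4, h0, h1, h2, h3, h4, h5, signedHyps_quadruple hij hjk hkl]

theorem exists_U_eq {i j k : Fin n} (hij : i < j) (hjk : j < k) (ε : Fin n → ℤˣ) :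
    ∃ q, U K q i j k = partitionSpace K form (balancedHyps {i, j, k} ε) pairColour := by
  obtain ⟨q, hq⟩ := exists_tripleSigns_eq (ε i) (ε j) (ε k)
  exact ⟨q, U_eq_of_signs K hij hjk hq⟩

theorem exists_V4_eq {i j k l : Fin n} (hij : i < j) (hjk : j < k) (hkl : k < l)
    (ε : Fin n → ℤˣ) :
    ∃ q, V4 K q i j k l =
      partitionSpace K form (balancedHyps {i, j, k, l} ε) (matchingColour i j k l) := by
  obtain ⟨q, hq⟩ := exists_quadSigns_eq (ε i) (ε j) (ε k) (ε l)
  exact ⟨q, V4_eq_of_signs K hij hjk hkl hq⟩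

theorem card_triple {i j k : Fin n} (hij : i < j) (hjk : j < k) :
    ({i, j, k} : Finset (Fin n)).card = 3 :=
  Finset.card_eq_three.2 ⟨i, j, k, hij.ne, (hij.trans hjk).ne, hjk.ne, rfl⟩

theorem card_quadruple {i j k l : Fin n} (hij : i < j) (hjk : j < k) (hkl : k < l) :
    ({i, j, k, l} : Finset (Fin n)).card = 4 := by
  rw [Finset.card_insert_of_notMem
    (by simp [hij.ne, (hij.trans hjk).ne, (hij.trans (hjk.trans hkl)).ne]),
    card_triple hjk hkl]

theorem isNet_V3 {i j k : Fin n} (hij : i < j) (hjk : j < k) :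
    IsNet {i, j, k} (pairHyps {(i, j), (i, k), (j, k)}) pairColour := by
  have hc := card_triple hij hjk
  rw [pairHyps_triple hij hjk]
  exact (isEdgeColouring_pairColour hc).isNet_fullHyps (.inl hc)

theorem isNet_U {i j k : Fin n} (hij : i < j) (hjk : j < k) (q : Fin 4) :
    IsNet {i, j, k} (signedHyps {(i, j, tripleSigns q 0), (i, k, tripleSigns q 1),
      (j, k, tripleSigns q 2)}) pairColour := by
  have hc := card_triple hij hjk
  obtain ⟨a, b, c, h0, h1, h2⟩ := tripleSigns_eq_switching q
  have h := signedHyps_triple hij hjk fun x => if x = i then a else if x = j then b else c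
  simp only [hij.ne', hjk.ne', (hij.trans hjk).ne', if_true, if_false] at h
  rw [h0, h1, h2, h]
  exact (isEdgeColouring_pairColour hc).isNet_balancedHyps (.inl hc) _

theorem isNet_W {i j k l : Fin n} (hij : i < j) (hjk : j < k) (hkl : k < l) :
    IsNet {i, j, k, l} (pairHyps {(i, j), (i, k), (i, l), (j, k), (j, l), (k, l)})
      (matchingColour i j k l) := by
  rw [pairHyps_quadruple hij hjk hkl]
  exact (isEdgeColouring_matchingColour hij hjk hkl).isNet_fullHyps
    (.inr (card_quadruple hij hjk hkl))

theorem isNet_V4 {i j k l : Fin n} (hij : i < j) (hjk : j < k) (hkl : k < l) (q : Fin 8) :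
    IsNet {i, j, k, l} (signedHyps {(i, j, quadSigns q 0), (i, k, quadSigns q 1),
      (i, l, quadSigns q 2), (j, k, quadSigns q 3), (j, l, quadSigns q 4), (k, l, quadSigns q 5)})
      (matchingColour i j k l) := by
  obtain ⟨a, b, c, d, h0, h1, h2, h3, h4, h5⟩ := quadSigns_eq_switching q
  have h := signedHyps_quadruple hij hjk hkl fun x =>
    if x = i then a else if x = j then b else if x = k then c else d
  simp only [hij.ne', hjk.ne', hkl.ne', (hij.trans hjk).ne', (hjk.trans hkl).ne',
    (hij.trans (hjk.trans hkl)).ne', if_true, if_false] at h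
  rw [h0, h1, h2, h3, h4, h5, h]
  exact (isEdgeColouring_matchingColour hij hjk hkl).isNet_balancedHyps
    (.inr (card_quadruple hij hjk hkl)) _

/-- Each listed space is the partition space of a net on the complete or on a balanced
subarrangement with three or four indices. -/
theorem exists_isNet_of_mem_componentList {L : Submodule K (Hyp n → K)}
    (hL : L ∈ componentList K n) :
    ∃ (κ : Type) (T : Finset (Fin n)) (B : Set (Hyp n)) (c : Hyp n → κ),
      IsNet T B c ∧ L = partitionSpace K form B c := by
  rcases hL with ⟨i, j, k, hij, hjk, rfl | ⟨q, rfl⟩⟩ | ⟨i, j, k, l, hij, hjk, hkl, rfl | ⟨q, rfl⟩⟩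
  · exact ⟨_, _, _, _, isNet_V3 hij hjk, rfl⟩
  · exact ⟨_, _, _, _, isNet_U hij hjk q, rfl⟩
  · exact ⟨_, _, _, _, isNet_W hij hjk hkl, rfl⟩
  · exact ⟨_, _, _, _, isNet_V4 hij hjk hkl q, rfl⟩

variable {K}

/-- The triangle equations of each complete or balanced subarrangement on three or four indices
define a listed space. -/
theorem exists_mem_componentList (h2 : (2 : K) ≠ 0) {T : Finset (Fin n)}
    (hT : T.card = 3 ∨ T.card = 4) {B : Set (Hyp n)}
    (hB : B = fullHyps T ∨ ∃ ε, B = balancedHyps T ε) {u : Hyp n → K}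
    (hu : TriangleSumZero B u) : ∃ L ∈ componentList K n, u ∈ L := by
  rcases hT with hc | hc
  · obtain ⟨i, j, k, hij, hjk, rfl⟩ := exists_sorted_triple hc
    rcases hB with rfl | ⟨ε, rfl⟩
    · refine ⟨_, .inl ⟨i, j, k, hij, hjk, .inl rfl⟩, ?_⟩
      rw [V3_eq K hij hjk]
      exact (((isEdgeColouring_pairColour hc).isNet_fullHyps (.inl hc)).mem_partitionSpace_iff
        h2 u).2 hu
    · obtain ⟨q, hq⟩ := exists_U_eq K hij hjk ε
      refine ⟨_, .inl ⟨i, j, k, hij, hjk, .inr ⟨q, rfl⟩⟩, ?_⟩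
      rw [hq]
      exact (((isEdgeColouring_pairColour hc).isNet_balancedHyps (.inl hc) ε).mem_partitionSpace_iff
        h2 u).2 hu
  · obtain ⟨i, j, k, l, hij, hjk, hkl, rfl⟩ := exists_sorted_quadruple hc
    rcases hB with rfl | ⟨ε, rfl⟩
    · refine ⟨_, .inr ⟨i, j, k, l, hij, hjk, hkl, .inl rfl⟩, ?_⟩
      rw [W_eq K hij hjk hkl]
      exact (((isEdgeColouring_matchingColour hij hjk hkl).isNet_fullHyps
        (.inr hc)).mem_partitionSpace_iff h2 u).2 hu
    · obtain ⟨q, hq⟩ := exists_V4_eq K hij hjk hkl ε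
      refine ⟨_, .inr ⟨i, j, k, l, hij, hjk, hkl, .inr ⟨q, rfl⟩⟩, ?_⟩
      rw [hq]
      exact (((isEdgeColouring_matchingColour hij hjk hkl).isNet_balancedHyps
        (.inr hc) ε).mem_partitionSpace_iff h2 u).2 hu

/-! ### The resonance variety of the arrangement of type D -/

/-- Two vectors `u` and `w`, read as a labelling of the hyperplanes by vectors in the plane. The
value for `p = q` is irrelevant. -/
def planeLabel (u w : Hyp n → K) (p q : Fin n) (τ : ℤˣ) : K × K :=
  if h : p ≠ q then (u (hyp p q h τ), w (hyp p q h τ)) else 0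

theorem planeLabel_of_ne (u w : Hyp n → K) {p q : Fin n} (h : p ≠ q) (τ : ℤˣ) :
    planeLabel u w p q τ = (u (hyp p q h τ), w (hyp p q h τ)) := dif_pos h

theorem isResonantLabelling_planeLabel {u w : Hyp n → K}
    (H1 : ∀ g h, IsOrthogonal g h → w g * u h = u g * w h)
    (H2 : ∀ g h k, IsTriangle g h k → w g * (u g + u h + u k) = u g * (w g + w h + w k)) :
    IsResonantLabelling (planeLabel u w) where
  symm p q h τ := by rw [planeLabel_of_ne _ _ h, planeLabel_of_ne _ _ h.symm, hyp_comm]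
  opposite p q h σ τ := by
    rw [planeLabel_of_ne _ _ h, planeLabel_of_ne _ _ h, planeDet]
    linear_combination -H1 _ _ (.inl ⟨p, q, h, σ, τ, rfl, rfl⟩)
  disjoint p q r l hpq hrl hpr hpl hqr hql σ τ := by
    rw [planeLabel_of_ne _ _ hpq, planeLabel_of_ne _ _ hrl, planeDet]
    linear_combination -H1 _ _ (.inr ⟨p, q, r, l, hpq, hrl, σ, τ, hpr, hpl, hqr, hql, rfl, rfl⟩)
  triangle p q r hpq hpr hqr σ τ := by
    rw [planeLabel_of_ne _ _ hpq, planeLabel_of_ne _ _ hpr, planeLabel_of_ne _ _ hqr, planeDet]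
    simp only [Prod.fst_add, Prod.snd_add]
    linear_combination -H2 _ _ _ ⟨p, q, r, hpq, hpr, hqr, σ, τ, rfl, rfl, rfl⟩

theorem exists_triangleSumZero_of_mem_resonanceVariety (hn : 3 ≤ n) {u : Hyp n → K}
    (hu : u ∈ resonanceVariety K (form (n := n))) :
    ∃ (T : Finset (Fin n)) (B : Set (Hyp n)), (T.card = 3 ∨ T.card = 4) ∧
      (B = fullHyps T ∨ ∃ ε, B = balancedHyps T ε) ∧ TriangleSumZero B u := by
  by_cases hu0 : u = 0
  · obtain ⟨T, -, hT⟩ := Finset.exists_subset_card_eq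
      (show 3 ≤ (Finset.univ : Finset (Fin n)).card by simpa using hn)
    exact ⟨T, _, .inl hT, .inl rfl, fun g _ => by simp [hu0], fun g h k _ _ _ _ => by simp [hu0]⟩
  obtain ⟨w, hw, H1, H2⟩ := (mem_resonanceVariety_form_iff u).1 hu
  have hV := isResonantLabelling_planeLabel H1 H2
  obtain ⟨g, hg⟩ := Function.ne_iff.1 hu0
  -- `w` is not a multiple of `u`, so that some `2 × 2` minor does not vanish
  obtain ⟨h, hh⟩ : ∃ h, w g * u h ≠ u g * w h := by
    by_contra! hcon
    refine hw (w g / u g) (funext fun h => ?_)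
    have := hcon h
    simp only [Pi.smul_apply, smul_eq_mul]
    simp only [Pi.zero_apply] at hg
    field_simp
    linear_combination -this
  obtain ⟨k, p, q, r, hpq, hpr, hqr, σ, τ, rfl, rfl, rfl⟩ :=
    (isOrthogonal_or_exists_isTriangle g h).resolve_left fun hort => hh (H1 g h hort)
  obtain ⟨T, hT, hsupp⟩ := hV.exists_support hpq hpr hqr (σ := σ) (τ := τ) (by
    rw [planeLabel_of_ne _ _ hpq, planeLabel_of_ne _ _ hpr, planeDet]
    exact fun h => hh (by linear_combination -h))
  have hne : ∀ {a b : Fin n} (hab : a ≠ b) (ρ : ℤˣ), u (hyp a b hab ρ) ≠ 0 →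
      planeLabel u w a b ρ ≠ 0 := by
    intro a b hab ρ h h'
    rw [planeLabel_of_ne _ _ hab] at h'
    exact h (congrArg Prod.fst h')
  have hsum : ∀ {a b d : Fin n} (hab : a ≠ b) (had : a ≠ d) (hbd : b ≠ d) (ρ ρ' : ℤˣ),
      planeDet (planeLabel u w a b ρ) (planeLabel u w a d ρ') ≠ 0 →
      u (hyp a b hab ρ) + u (hyp a d had ρ') + u (hyp b d hbd (ρ * ρ')) = 0 := by
    intro a b d hab had hbd ρ ρ' h
    have := hV.sum_eq_zero hab had hbd h
    rw [planeLabel_of_ne _ _ hab, planeLabel_of_ne _ _ had, planeLabel_of_ne _ _ hbd] at this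
    exact congrArg Prod.fst this
  rcases hsupp with ⟨ε, hR, hs⟩ | ⟨hR, hs⟩
  · refine ⟨T, balancedHyps T ε, hT, .inr ⟨ε, rfl⟩, fun m hm => ?_, ?_⟩
    · obtain ⟨a, b, hab, ρ, rfl⟩ := exists_eq_hyp m
      by_contra h
      exact hm ((hyp_mem_balancedHyps hab.ne ρ).2 (hs a b hab.ne ρ (hne hab.ne ρ h)))
    · rintro _ _ _ ⟨a, b, d, hab, had, hbd, ρ, ρ', rfl, rfl, rfl⟩ h1 h2 -
      rw [hyp_mem_balancedHyps] at h1 h2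
      refine hsum hab had hbd ρ ρ' ?_
      rw [h1.2.2, h2.2.2]
      exact hR a h1.1 b h1.2.1 d h2.2.1 hab had hbd
  · refine ⟨T, fullHyps T, hT, .inl rfl, fun m hm => ?_, ?_⟩
    · obtain ⟨a, b, hab, ρ, rfl⟩ := exists_eq_hyp m
      by_contra h
      exact hm ((hyp_mem_fullHyps hab.ne ρ).2 (hs a b hab.ne ρ (hne hab.ne ρ h)))
    · rintro _ _ _ ⟨a, b, d, hab, had, hbd, ρ, ρ', rfl, rfl, rfl⟩ h1 h2 -
      rw [hyp_mem_fullHyps] at h1 h2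
      exact hsum hab had hbd ρ ρ' (hR a h1.1 b h1.2 d h2.2 hab had hbd ρ ρ')

/-- The resonance variety of the arrangement of type D is the union of the listed spaces. -/
theorem resonanceVariety_form_eq_iUnion (h2 : (2 : K) ≠ 0) (hn : 3 ≤ n) :
    resonanceVariety K (form (n := n)) = ⋃ L ∈ componentList K n, (L : Set (Hyp n → K)) := by
  ext u
  rw [Set.mem_iUnion₂]
  constructor
  · intro hu
    obtain ⟨T, B, hT, hB, hu⟩ := exists_triangleSumZero_of_mem_resonanceVariety hn hu
    obtain ⟨L, hL, huL⟩ := exists_mem_componentList h2 hT hB hu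
    exact ⟨L, hL, huL⟩
  · rintro ⟨L, hL, huL⟩
    obtain ⟨κ, T, B, c, hB, rfl⟩ := exists_isNet_of_mem_componentList K hL
    exact hB.partitionSpace_subset_resonanceVariety h2 huL

end TypeD

/-! ### Finite unions of linear subspaces in the Zariski topology -/

section Zariski

variable {K ι : Type*} [Field K]

/-- The principal open sets form a basis of the Zariski topology. -/
theorem exists_eval_ne_zero_of_isOpen {U : Set (ι → K)}
    (hU : @IsOpen (ι → K) (zariskiTopology K ι) U) {x : ι → K} (hx : x ∈ U) :
    ∃ p : MvPolynomial ι K, MvPolynomial.eval x p ≠ 0 ∧ ∀ y, MvPolynomial.eval y p ≠ 0 → y ∈ U := by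
  induction hU with
  | basic s hs =>
    obtain ⟨p, rfl⟩ := hs
    exact ⟨p, hx, fun y hy => hy⟩
  | univ => exact ⟨1, by simp, fun y _ => trivial⟩
  | inter s t _ _ ihs iht =>
    obtain ⟨p, hp, hps⟩ := ihs hx.1
    obtain ⟨q, hq, hqt⟩ := iht hx.2
    refine ⟨p * q, by rw [map_mul]; exact mul_ne_zero hp hq, fun y hy => ?_⟩
    rw [map_mul] at hy
    exact ⟨hps y (left_ne_zero_of_mul hy), hqt y (right_ne_zero_of_mul hy)⟩
  | sUnion S _ ih =>
    obtain ⟨s, hs, hxs⟩ := hx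
    obtain ⟨p, hp, hps⟩ := ih s hs hxs
    exact ⟨p, hp, fun y hy => ⟨s, hs, hps y hy⟩⟩

/-- Over an infinite field two nonempty open subsets of a linear space intersect: restrict their
equations to a line through a point of each. -/
theorem isIrreducible_submodule [Infinite K] (L : Submodule K (ι → K)) :
    @IsIrreducible (ι → K) (zariskiTopology K ι) (L : Set (ι → K)) := by
  refine ⟨⟨0, L.zero_mem⟩, ?_⟩
  rintro U V hU hV ⟨x, hxL, hxU⟩ ⟨y, hyL, hyV⟩
  obtain ⟨p, hp, hpU⟩ := exists_eval_ne_zero_of_isOpen hU hxU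
  obtain ⟨q, hq, hqV⟩ := exists_eval_ne_zero_of_isOpen hV hyV
  let line : ι → Polynomial K := fun i =>
    Polynomial.C (x i) + Polynomial.X * Polynomial.C (y i - x i)
  have heval : ∀ (t : K) (f : MvPolynomial ι K),
      Polynomial.eval t (MvPolynomial.aeval line f) = MvPolynomial.eval (x + t • (y - x)) f := by
    intro t f
    induction f using MvPolynomial.induction_on with
    | C a => simp
    | add f g hf hg => simp only [map_add, Polynomial.eval_add, hf, hg]
    | mul_X f i hf =>
      simp only [map_mul, Polynomial.eval_mul, hf, MvPolynomial.aeval_X, MvPolynomial.eval_X, line]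
      simp
  have hp' : MvPolynomial.aeval line p ≠ 0 := by
    intro h
    have := heval 0 p
    rw [h] at this
    simp at this
    exact hp this.symm
  have hq' : MvPolynomial.aeval line q ≠ 0 := by
    intro h
    have := heval 1 q
    rw [h] at this
    simp at this
    exact hq this.symm
  obtain ⟨t, ht⟩ : ∃ t,
      Polynomial.eval t (MvPolynomial.aeval line p * MvPolynomial.aeval line q) ≠ 0 := by
    by_contra! hcon
    exact mul_ne_zero hp' hq' (Polynomial.funext fun t => by rw [hcon t, Polynomial.eval_zero])
  rw [Polynomial.eval_mul, heval, heval] at ht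
  exact ⟨x + t • (y - x), L.add_mem hxL (L.smul_mem t (L.sub_mem hyL hxL)),
    hpU _ (left_ne_zero_of_mul ht), hqV _ (right_ne_zero_of_mul ht)⟩

theorem isClosed_submodule [Finite ι] (L : Submodule K (ι → K)) :
    @IsClosed (ι → K) (zariskiTopology K ι) (L : Set (ι → K)) := by
  classical
  have := Fintype.ofFinite ι
  let _ := zariskiTopology K ι
  rw [← isOpen_compl_iff]
  -- the complement is the union of the open sets of points where a linear form vanishing on `L`
  -- does not vanish
  have heq : ((L : Set (ι → K))ᶜ) = ⋃₀ {U | ∃ φ ∈ L.dualAnnihilator, U =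
      {x | MvPolynomial.eval x
        (∑ i, MvPolynomial.C (φ (Pi.single i 1)) * MvPolynomial.X i) ≠ 0}} := by
    have hφ : ∀ (φ : Module.Dual K (ι → K)) (x : ι → K),
        MvPolynomial.eval x (∑ i, MvPolynomial.C (φ (Pi.single i 1)) * MvPolynomial.X i) = φ x := by
      intro φ x
      conv_rhs => rw [LinearMap.pi_apply_eq_sum_univ φ x]
      rw [map_sum]
      refine Finset.sum_congr rfl fun i _ => ?_
      rw [map_mul, MvPolynomial.eval_C, MvPolynomial.eval_X, smul_eq_mul, mul_comm]
      congr 2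
      ext j
      simp [Pi.single_apply, eq_comm]
    ext x
    simp only [hφ]
    constructor
    · intro hx
      obtain ⟨φ, hφx, hφL⟩ := Submodule.exists_le_ker_of_notMem hx
      exact ⟨_, ⟨φ, (Submodule.mem_dualAnnihilator φ).2 fun w hw => hφL hw, rfl⟩, hφx⟩
    · rintro ⟨_, ⟨φ, hφL, rfl⟩, hx⟩ hxL
      exact hx ((Submodule.mem_dualAnnihilator φ).1 hφL x hxL)
  rw [heq]
  refine isOpen_sUnion ?_
  rintro _ ⟨φ, -, rfl⟩
  exact TopologicalSpace.isOpen_generateFrom_of_mem ⟨_, rfl⟩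

/-- If finitely many linear subspaces are pairwise not contained in each other, they are the
irreducible components of their union. -/
theorem zariskiComponents_iUnion [Infinite K] [Finite ι] {F : Set (Submodule K (ι → K))}
    (hF : F.Finite) (hanti : ∀ L ∈ F, ∀ M ∈ F, L ≤ M → L = M) :
    zariskiComponents (⋃ L ∈ F, (L : Set (ι → K))) =
      (fun L : Submodule K (ι → K) => (L : Set (ι → K))) '' F := by
  classical
  let _ := zariskiTopology K ι
  -- an irreducible subset of the union lies in one of the finitely many closed pieces
  have hsub : ∀ Y : Set (ι → K), Y ⊆ (⋃ L ∈ F, (L : Set (ι → K))) → IsIrreducible Y →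
      ∃ L ∈ F, Y ⊆ (L : Set (ι → K)) := by
    intro Y hY hirr
    obtain ⟨z, hz, hYz⟩ := isIrreducible_iff_sUnion_isClosed.1 hirr
      (hF.toFinset.image fun L : Submodule K (ι → K) => (L : Set (ι → K))) (by
        intro z hz
        obtain ⟨L, -, rfl⟩ := Finset.mem_image.1 hz
        exact isClosed_submodule L) (by
        intro y hy
        obtain ⟨L, hL, hyL⟩ := Set.mem_iUnion₂.1 (hY hy)
        exact ⟨L, by simpa using hL, hyL⟩)
    obtain ⟨L, hL, rfl⟩ := Finset.mem_image.1 hz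
    exact ⟨L, hF.mem_toFinset.1 hL, hYz⟩
  have hmem : ∀ L ∈ F, (L : Set (ι → K)) ⊆ (⋃ L ∈ F, (L : Set (ι → K))) ∧
      IsIrreducible (L : Set (ι → K)) :=
    fun L hL => ⟨Set.subset_biUnion_of_mem
      (u := fun L : Submodule K (ι → K) => (L : Set (ι → K))) hL,
      isIrreducible_submodule L⟩
  ext Z
  constructor
  · intro hZ
    have hZ : Maximal (fun Y => Y ⊆ (⋃ L ∈ F, (L : Set (ι → K))) ∧ IsIrreducible Y) Z := hZ
    obtain ⟨L, hL, hZL⟩ := hsub Z hZ.prop.1 hZ.prop.2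
    exact ⟨L, hL, (hZ.eq_of_subset (hmem L hL) hZL).symm⟩
  · rintro ⟨L, hL, rfl⟩
    refine ⟨hmem L hL, fun Y hY hLY => ?_⟩
    obtain ⟨M, hM, hYM⟩ := hsub Y hY.1 hY.2
    have hLM : L = M := hanti L hL M hM (fun x hx => hYM (hLY hx))
    rw [hLM]
    exact hYM

end Zariski

/-! ### Counting the components -/

namespace TypeD

variable {n : ℕ}

theorem tripleSigns_injective {q q' : Fin 4} (h0 : tripleSigns q 0 = tripleSigns q' 0)
    (h1 : tripleSigns q 1 = tripleSigns q' 1) (h2 : tripleSigns q 2 = tripleSigns q' 2) :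
    q = q' := by
  revert q q'
  decide

theorem quadSigns_injective {q q' : Fin 8} (h0 : quadSigns q 0 = quadSigns q' 0)
    (h1 : quadSigns q 1 = quadSigns q' 1) (h2 : quadSigns q 2 = quadSigns q' 2) :
    q = q' := by
  revert q q'
  decide

/-- The subarrangements on three indices: `none` stands for all hyperplanes, `some q` for the
balanced subarrangement with sign pattern `q`. -/
def tripleHyps (i j k : Fin n) : Option (Fin 4) → Set (Hyp n)
  | none => pairHyps {(i, j), (i, k), (j, k)}
  | some q => signedHyps {(i, j, tripleSigns q 0), (i, k, tripleSigns q 1), (j, k, tripleSigns q 2)}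

/-- The subarrangements on four indices: `none` stands for all hyperplanes, `some q` for the
balanced subarrangement with sign pattern `q`. -/
def quadHyps (i j k l : Fin n) : Option (Fin 8) → Set (Hyp n)
  | none => pairHyps {(i, j), (i, k), (i, l), (j, k), (j, l), (k, l)}
  | some q => signedHyps {(i, j, quadSigns q 0), (i, k, quadSigns q 1), (i, l, quadSigns q 2),
      (j, k, quadSigns q 3), (j, l, quadSigns q 4), (k, l, quadSigns q 5)}

theorem isNet_tripleHyps {i j k : Fin n} (hij : i < j) (hjk : j < k) (o : Option (Fin 4)) :
    IsNet {i, j, k} (tripleHyps i j k o) pairColour := by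
  cases o with
  | none => exact isNet_V3 hij hjk
  | some q => exact isNet_U hij hjk q

theorem isNet_quadHyps {i j k l : Fin n} (hij : i < j) (hjk : j < k) (hkl : k < l)
    (o : Option (Fin 8)) : IsNet {i, j, k, l} (quadHyps i j k l o) (matchingColour i j k l) := by
  cases o with
  | none => exact isNet_W hij hjk hkl
  | some q => exact isNet_V4 hij hjk hkl q

theorem tripleHyps_injective {i j k : Fin n} (hij : i < j) (hjk : j < k) :
    Function.Injective (tripleHyps i j k) := by
  have hik := hij.trans hjk
  have m0 : ∀ (q : Fin 4) (s : ℤˣ), (⟨(i, j, s), hij⟩ : Hyp n) ∈ tripleHyps i j k (some q) ↔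
      s = tripleSigns q 0 := by
    intro q s
    simp [tripleHyps, signedHyps, hij.ne, hjk.ne]
  have m1 : ∀ (q : Fin 4) (s : ℤˣ), (⟨(i, k, s), hik⟩ : Hyp n) ∈ tripleHyps i j k (some q) ↔
      s = tripleSigns q 1 := by
    intro q s
    simp [tripleHyps, signedHyps, hij.ne, hjk.ne']
  have m2 : ∀ (q : Fin 4) (s : ℤˣ), (⟨(j, k, s), hjk⟩ : Hyp n) ∈ tripleHyps i j k (some q) ↔
      s = tripleSigns q 2 := by
    intro q s
    simp [tripleHyps, signedHyps, hij.ne']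
  have hall : ∀ s : ℤˣ, (⟨(i, j, s), hij⟩ : Hyp n) ∈ tripleHyps i j k none := by
    intro s
    simp [tripleHyps, pairHyps]
  have hno : ∀ q : Fin 4, tripleHyps i j k none ≠ tripleHyps i j k (some q) := by
    intro q h
    have h1 := (m0 q 1).1 (h ▸ hall 1)
    have h2 := (m0 q (-1)).1 (h ▸ hall (-1))
    exact absurd (h1.trans h2.symm) (by decide)
  intro o o' h
  rcases o with _ | q <;> rcases o' with _ | q'
  · rfl
  · exact absurd h (hno q')
  · exact absurd h.symm (hno q)
  · exact congrArg some (tripleSigns_injective (q := q) (q' := q')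
      ((m0 q' _).1 (h ▸ (m0 q _).2 rfl))
      ((m1 q' _).1 (h ▸ (m1 q _).2 rfl)) ((m2 q' _).1 (h ▸ (m2 q _).2 rfl)))

theorem quadHyps_injective {i j k l : Fin n} (hij : i < j) (hjk : j < k) (hkl : k < l) :
    Function.Injective (quadHyps i j k l) := by
  have hik := hij.trans hjk
  have hjl := hjk.trans hkl
  have hil := hij.trans hjl
  have m0 : ∀ (q : Fin 8) (s : ℤˣ), (⟨(i, j, s), hij⟩ : Hyp n) ∈ quadHyps i j k l (some q) ↔
      s = quadSigns q 0 := by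
    intro q s
    simp [quadHyps, signedHyps, hij.ne, hjk.ne, hik.ne, hjl.ne]
  have m1 : ∀ (q : Fin 8) (s : ℤˣ), (⟨(i, k, s), hik⟩ : Hyp n) ∈ quadHyps i j k l (some q) ↔
      s = quadSigns q 1 := by
    intro q s
    simp [quadHyps, signedHyps, hij.ne, hjk.ne', hik.ne, hkl.ne]
  have m2 : ∀ (q : Fin 8) (s : ℤˣ), (⟨(i, l, s), hil⟩ : Hyp n) ∈ quadHyps i j k l (some q) ↔
      s = quadSigns q 2 := by
    intro q s
    simp [quadHyps, signedHyps, hij.ne, hjl.ne', hik.ne, hkl.ne']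
  have hall : ∀ s : ℤˣ, (⟨(i, j, s), hij⟩ : Hyp n) ∈ quadHyps i j k l none := by
    intro s
    simp [quadHyps, pairHyps]
  have hno : ∀ q : Fin 8, quadHyps i j k l none ≠ quadHyps i j k l (some q) := by
    intro q h
    have h1 := (m0 q 1).1 (h ▸ hall 1)
    have h2 := (m0 q (-1)).1 (h ▸ hall (-1))
    exact absurd (h1.trans h2.symm) (by decide)
  intro o o' h
  rcases o with _ | q <;> rcases o' with _ | q'
  · rfl
  · exact absurd h (hno q')
  · exact absurd h.symm (hno q)
  · exact congrArg some (quadSigns_injective (q := q) (q' := q') ((m0 q' _).1 (h ▸ (m0 q _).2 rfl))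
      ((m1 q' _).1 (h ▸ (m1 q _).2 rfl)) ((m2 q' _).1 (h ▸ (m2 q _).2 rfl)))

/-- The net is determined by its partition space, being the set of hyperplanes at which some vector
of the space has a nonzero coordinate. -/
theorem IsNet.eq_of_partitionSpace_eq {K : Type*} [Field K] (h2 : (2 : K) ≠ 0) {κ κ' : Type*}
    {T T' : Finset (Fin n)} {B B' : Set (Hyp n)} {c : Hyp n → κ} {c' : Hyp n → κ'}
    (hB : IsNet T B c) (hB' : IsNet T' B' c')
    (h : partitionSpace K form B c = partitionSpace K form B' c') : B = B' := by
  ext g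
  rw [hB.mem_iff_exists_ne_zero h2, hB'.mem_iff_exists_ne_zero h2, h]

theorem IsNet.vertices_subset {κ κ' : Type*} {T T' : Finset (Fin n)} {B : Set (Hyp n)}
    {c : Hyp n → κ} {c' : Hyp n → κ'} (hB : IsNet T B c) (hB' : IsNet T' B c') : T ⊆ T' := by
  intro p hp
  obtain ⟨q, hq, hpq, -⟩ := hB.exists_third p p
  obtain ⟨τ, hτ⟩ := hB.full p hp q hq hpq
  exact (hB'.mem p q hpq τ hτ).1

theorem IsNet.vertices_eq {κ κ' : Type*} {T T' : Finset (Fin n)} {B : Set (Hyp n)}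
    {c : Hyp n → κ} {c' : Hyp n → κ'} (hB : IsNet T B c) (hB' : IsNet T' B c') : T = T' :=
  (hB.vertices_subset hB').antisymm (hB'.vertices_subset hB)

/-- The index set of the components: increasing triples with five patterns each and increasing
quadruples with nine patterns each. -/
abbrev ComponentIndex (n : ℕ) : Type :=
  ((Fin 3 ↪o Fin n) × Option (Fin 4)) ⊕ ((Fin 4 ↪o Fin n) × Option (Fin 8))

/-- The component with a given index. -/
noncomputable def component (K : Type*) [Field K] : ComponentIndex n → Submodule K (Hyp n → K)
  | .inl (e, o) => partitionSpace K form (tripleHyps (e 0) (e 1) (e 2) o) pairColour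
  | .inr (e, o) => partitionSpace K form (quadHyps (e 0) (e 1) (e 2) (e 3) o)
      (matchingColour (e 0) (e 1) (e 2) (e 3))

theorem card_orderEmbedding (k n : ℕ) : Nat.card (Fin k ↪o Fin n) = n.choose k := by
  rw [Nat.card_congr Set.powersetCard.ofFinEmbEquiv, Set.powersetCard.card, Nat.card_fin]

theorem range_three (e : Fin 3 ↪o Fin n) :
    Set.range e = (({e 0, e 1, e 2} : Finset (Fin n)) : Set (Fin n)) := by
  ext x
  simp only [Set.mem_range, Fin.exists_fin_succ]
  simp [eq_comm]

theorem range_four (e : Fin 4 ↪o Fin n) :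
    Set.range e = (({e 0, e 1, e 2, e 3} : Finset (Fin n)) : Set (Fin n)) := by
  ext x
  simp only [Set.mem_range, Fin.exists_fin_succ]
  simp [eq_comm]

variable (K : Type*) [Field K]

theorem component_injective (h2 : (2 : K) ≠ 0) :
    Function.Injective (component K : ComponentIndex n → _) := by
  have lt3 : ∀ (e : Fin 3 ↪o Fin n), e 0 < e 1 ∧ e 1 < e 2 := fun e =>
    ⟨e.strictMono (by decide), e.strictMono (by decide)⟩
  have lt4 : ∀ (e : Fin 4 ↪o Fin n), e 0 < e 1 ∧ e 1 < e 2 ∧ e 2 < e 3 := fun e =>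
    ⟨e.strictMono (by decide), e.strictMono (by decide), e.strictMono (by decide)⟩
  have net3 := fun (e : Fin 3 ↪o Fin n) o => isNet_tripleHyps (lt3 e).1 (lt3 e).2 o
  have net4 := fun (e : Fin 4 ↪o Fin n) o => isNet_quadHyps (lt4 e).1 (lt4 e).2.1 (lt4 e).2.2 o
  have hne : ∀ (e : Fin 3 ↪o Fin n) o (e' : Fin 4 ↪o Fin n) o',
      component K (.inl (e, o)) ≠ component K (.inr (e', o')) := by
    intro e o e' o' h
    have hB := (net3 e o).eq_of_partitionSpace_eq h2 (net4 e' o') h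
    have hnet := net3 e o
    rw [hB] at hnet
    have hT := congrArg Finset.card (hnet.vertices_eq (net4 e' o'))
    rw [card_triple (lt3 e).1 (lt3 e).2, card_quadruple (lt4 e').1 (lt4 e').2.1 (lt4 e').2.2] at hT
    omega
  rintro (⟨e, o⟩ | ⟨e, o⟩) (⟨e', o'⟩ | ⟨e', o'⟩) h
  · have hB := (net3 e o).eq_of_partitionSpace_eq h2 (net3 e' o') h
    have hnet := net3 e o
    rw [hB] at hnet
    have hT := hnet.vertices_eq (net3 e' o')
    obtain rfl : e = e' := OrderEmbedding.range_inj.1 (by rw [range_three, range_three, hT])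
    rw [tripleHyps_injective (lt3 e).1 (lt3 e).2 hB]
  · exact absurd h (hne _ _ _ _)
  · exact absurd h.symm (hne _ _ _ _)
  · have hB := (net4 e o).eq_of_partitionSpace_eq h2 (net4 e' o') h
    have hnet := net4 e o
    rw [hB] at hnet
    have hT := hnet.vertices_eq (net4 e' o')
    obtain rfl : e = e' := OrderEmbedding.range_inj.1 (by rw [range_four, range_four, hT])
    rw [quadHyps_injective (lt4 e).1 (lt4 e).2.1 (lt4 e).2.2 hB]

theorem range_component : Set.range (component K : ComponentIndex n → _) = componentList K n := by
  ext L
  constructor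
  · rintro ⟨⟨e, _ | q⟩ | ⟨e, _ | q⟩, rfl⟩
    · exact .inl ⟨e 0, e 1, e 2, e.strictMono (by decide), e.strictMono (by decide), .inl rfl⟩
    · exact .inl ⟨e 0, e 1, e 2, e.strictMono (by decide), e.strictMono (by decide), .inr ⟨q, rfl⟩⟩
    · exact .inr ⟨e 0, e 1, e 2, e 3, e.strictMono (by decide), e.strictMono (by decide),
        e.strictMono (by decide), .inl rfl⟩
    · exact .inr ⟨e 0, e 1, e 2, e 3, e.strictMono (by decide), e.strictMono (by decide),
        e.strictMono (by decide), .inr ⟨q, rfl⟩⟩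
  · have emb3 : ∀ {i j k : Fin n}, i < j → j < k → StrictMono ![i, j, k] := by
      intro i j k hij hjk
      rw [Fin.strictMono_iff_lt_succ]
      intro a
      fin_cases a
      · exact hij
      · exact hjk
    have emb4 : ∀ {i j k l : Fin n}, i < j → j < k → k < l → StrictMono ![i, j, k, l] := by
      intro i j k l hij hjk hkl
      rw [Fin.strictMono_iff_lt_succ]
      intro a
      fin_cases a
      · exact hij
      · exact hjk
      · exact hkl
    rintro (⟨i, j, k, hij, hjk, rfl | ⟨q, rfl⟩⟩ | ⟨i, j, k, l, hij, hjk, hkl, rfl | ⟨q, rfl⟩⟩)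
    · exact ⟨.inl (OrderEmbedding.ofStrictMono _ (emb3 hij hjk), none), rfl⟩
    · exact ⟨.inl (OrderEmbedding.ofStrictMono _ (emb3 hij hjk), some q), rfl⟩
    · exact ⟨.inr (OrderEmbedding.ofStrictMono _ (emb4 hij hjk hkl), none), rfl⟩
    · exact ⟨.inr (OrderEmbedding.ofStrictMono _ (emb4 hij hjk hkl), some q), rfl⟩

theorem finite_componentList : (componentList K n).Finite := by
  rw [← range_component]
  exact Set.finite_range _

theorem ncard_componentList (h2 : (2 : K) ≠ 0) :
    (componentList K n).ncard = 5 * n.choose 3 + 9 * n.choose 4 := by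
  rw [← range_component, ← Nat.card_coe_set_eq,
    Nat.card_range_of_injective (component_injective K h2), Nat.card_sum, Nat.card_prod,
    Nat.card_prod, card_orderEmbedding, card_orderEmbedding]
  simp
  ring

variable {K}

theorem finrank_of_mem_componentList (h2 : (2 : K) ≠ 0) {L : Submodule K (Hyp n → K)}
    (hL : L ∈ componentList K n) : Module.finrank K L = 2 := by
  obtain ⟨κ, T, B, c, hB, rfl⟩ := exists_isNet_of_mem_componentList K hL
  exact hB.finrank_partitionSpace h2

end TypeD

theorem mainTheorem5 (K : Type*) [Field K] [CharZero K] (n : ℕ) (hn : 3 ≤ n) :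
    resonanceVariety K (TypeD.form (n := n)) =
        (⋃ (i : Fin n) (j : Fin n) (k : Fin n) (_ : i < j) (_ : j < k),
          ((TypeD.V3 K i j k : Set (TypeD.Hyp n → K)) ∪
            ⋃ q : Fin 4, (TypeD.U K q i j k : Set (TypeD.Hyp n → K)))) ∪
        (⋃ (i : Fin n) (j : Fin n) (k : Fin n) (l : Fin n) (_ : i < j) (_ : j < k) (_ : k < l),
          ((TypeD.W K i j k l : Set (TypeD.Hyp n → K)) ∪
            ⋃ q : Fin 8, (TypeD.V4 K q i j k l : Set (TypeD.Hyp n → K)))) ∧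
      zariskiComponents (resonanceVariety K (TypeD.form (n := n))) =
        (fun L : Submodule K (TypeD.Hyp n → K) => (L : Set (TypeD.Hyp n → K))) ''
          TypeD.componentList K n ∧
      (∀ L ∈ TypeD.componentList K n, Module.finrank K L = 2) ∧
      (zariskiComponents (resonanceVariety K (TypeD.form (n := n)))).ncard =
        5 * n.choose 3 + 9 * n.choose 4 := by
  have h2 : (2 : K) ≠ 0 := two_ne_zero
  have hres := TypeD.resonanceVariety_form_eq_iUnion h2 hn
  have hrank : ∀ L ∈ TypeD.componentList K n, Module.finrank K L = 2 :=
    fun L hL => TypeD.finrank_of_mem_componentList h2 hL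
  have hcomp : zariskiComponents (resonanceVariety K (TypeD.form (n := n))) =
      (fun L : Submodule K (TypeD.Hyp n → K) => (L : Set (TypeD.Hyp n → K))) ''
        TypeD.componentList K n := by
    rw [hres]
    -- distinct listed spaces are not contained in each other as they have the same dimension
    exact zariskiComponents_iUnion (TypeD.finite_componentList K) fun L hL M hM hLM =>
      Submodule.eq_of_le_of_finrank_eq hLM ((hrank L hL).trans (hrank M hM).symm)
  refine ⟨?_, hcomp, hrank, ?_⟩
  · rw [hres]
    ext u
    simp only [Set.mem_iUnion, Set.mem_union, SetLike.mem_coe, exists_prop]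
    constructor
    · rintro ⟨L, ⟨i, j, k, hij, hjk, rfl | ⟨q, rfl⟩⟩ | ⟨i, j, k, l, hij, hjk, hkl, rfl | ⟨q, rfl⟩⟩,
        hu⟩
      · exact .inl ⟨i, j, k, hij, hjk, .inl hu⟩
      · exact .inl ⟨i, j, k, hij, hjk, .inr ⟨q, hu⟩⟩
      · exact .inr ⟨i, j, k, l, hij, hjk, hkl, .inl hu⟩
      · exact .inr ⟨i, j, k, l, hij, hjk, hkl, .inr ⟨q, hu⟩⟩
    · rintro (⟨i, j, k, hij, hjk, hu | ⟨q, hu⟩⟩ | ⟨i, j, k, l, hij, hjk, hkl, hu | ⟨q, hu⟩⟩)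
      · exact ⟨_, .inl ⟨i, j, k, hij, hjk, .inl rfl⟩, hu⟩
      · exact ⟨_, .inl ⟨i, j, k, hij, hjk, .inr ⟨q, rfl⟩⟩, hu⟩
      · exact ⟨_, .inr ⟨i, j, k, l, hij, hjk, hkl, .inl rfl⟩, hu⟩
      · exact ⟨_, .inr ⟨i, j, k, l, hij, hjk, hkl, .inr ⟨q, rfl⟩⟩, hu⟩
  · rw [hcomp, Set.ncard_image_of_injective _ SetLike.coe_injective, TypeD.ncard_componentList K h2]
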